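/- Let $G$ be a connected (finite-dimensional, real) Lie group with Lie algebra $\mathfrak g=T_eG$ (bracket of left-invariant vector fields), and let $(A,[\![\cdot,\cdot]\!],\rho)$ be a Lie algebroid of finite rank over a smooth manifold $M$ with projection $\tau:A\to M$ (so $[\![\cdot,\cdot]\!]$ is a Lie bracket on the space $\Gamma(A)$ of smooth sections, $\rho:A\to TM$ is a vector bundle map over $\mathrm{id}_M$, and $[\![X,fY]\!]=f[\![X,Y]\!]+\rho(X)(f)Y$). For $X\in\Gamma(A)$, let $X^v$ be the vertical lift of $X$, $X^v(a)=\frac{d}{dt}\big|_{t=0}\big(a+tX(\tau(a))\big)$, and let $X^c$ be the complete lift of $X$, i.e. the unique vector field on $A$ that is $\tau$-projectable on $\rho(X)$ and satisfies $X^c(\widehat\alpha)=\widehat{\mathcal L^A_X\alpha}$ for all $\alpha\in\Gamma(A^*)$. Here $\widehat\alpha:A\to\mathbb R$ is the fibrewise linear function defined by $\alpha$, and $(\mathcal L^A_X\alpha)(Y)=\rho(X)(\alpha(Y))-\alpha([\![X,Y]\!])$, i.e. $\mathcal L^A_X=i_Xd^A+d^Ai_X$. The infinitesimal generator $\xi_N$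 of a smooth left action $\Psi:K\times N\to N$ of a Lie group $K$ at $\xi\in T_eK$ is the vector field whose value at $a\in N$ is the image of $\xi$ under the derivative at $e$ of $k\mapsto\Psi(k,a)$. Let $\Phi:G\times A\to A$ be a smooth left action by vector bundle automorphisms, and let $\psi:\mathfrak g\to\Gamma(A)$ be a linear map with $\psi([\xi,\eta])=-[\![\psi(\xi),\psi(\eta)]\!]$ such that, for every $\xi\in\mathfrak g$, the infinitesimal generator of $\xi$ with respect to $\Phi$ is $\psi(\xi)^c$ (that is, $\Phi$ is an action by complete lifts with respect to $\psi$). Identify the tangent group $TG$ (whose multiplication is the tangent map of that of $G$) with $G\times\mathfrak g$ by $X_g\mapsto(g,T_gl_{g^{-1}}X_g)$; its multiplication becomes $(g,\xi)(h,\eta)=(gh,\eta+\mathrm{Ad}_{h^{-1}}\xi)$. Then $$\Phi^T:(G\times\mathfrak g)\times A\to A,\qquad \Phi^T((g,\xi),a_x)=\Phi_g\big(a_x+\psi(\xi)(x)\big)\quad(a_x\in A_x),$$ is a smooth affine left action of $TG\cong G\times\mathfrak g$ on $A$, i.e. a smooth left action such that each $\Phi^T_{(g,\xi)}$ maps every fibre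 of $A$ to a fibre of $A$ by an affine map. Moreover, for all $(\xi,\eta)\in\mathfrak g\times\mathfrak g$, the infinitesimal generator of $(\xi,\eta)$ with respect to $\Phi^T$ is $$(\xi,\eta)_A=\psi(\xi)^c+\psi(\eta)^v.$$ -/

import Mathlib

open Bundle
open scoped Manifold ContDiff

noncomputable section

/-! ### The tangent group `TG ≅ G × 𝔤` -/

section TangentGroup

variable {EG : Type*} [NormedAddCommGroup EG] [NormedSpace ℝ EG]
  {HG : Type*} [TopologicalSpace HG] (IG : ModelWithCorners ℝ EG HG)
  (G : Type*) [TopologicalSpace G] [ChartedSpace HG G] [Group G]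

/-- The adjoint action `Ad_g`, the derivative at `1` of the conjugation `h ↦ g h g⁻¹`. -/
def lieAd {G : Type*} [TopologicalSpace G] [ChartedSpace HG G] [Group G] (g : G) :
    GroupLieAlgebra IG G →L[ℝ] GroupLieAlgebra IG G :=
  (mfderiv IG IG (fun h : G => g * h * g⁻¹) 1 : EG →L[ℝ] EG)

/-- The manifold `G × 𝔤`, where `𝔤 = T₁G`; it underlies the tangent group of `G`. (The Lie algebra
`𝔤 = T₁G` is, as a vector space, the model vector space of `G`.) -/
def TangentGroup (_ : ModelWithCorners ℝ EG HG) (G : Type*) : Type _ := G × EG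

instance : TopologicalSpace (TangentGroup IG G) := inferInstanceAs (TopologicalSpace (G × EG))

instance : ChartedSpace (ModelProd HG EG) (TangentGroup IG G) :=
  inferInstanceAs (ChartedSpace (ModelProd HG EG) (G × EG))

variable {IG G}

/-- The group component of an element of `G × 𝔤`. -/
def TangentGroup.base (k : TangentGroup IG G) : G := k.1

/-- The Lie algebra component of an element of `G × 𝔤`. -/
def TangentGroup.vec (k : TangentGroup IG G) : GroupLieAlgebra IG G := k.2

/-- The element `(g, ξ)` of `G × 𝔤`. -/
def TangentGroup.mk (g : G) (ξ : GroupLieAlgebra IG G) : TangentGroup IG G := (g, ξ)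

end TangentGroup

section TangentGroupGroup

variable {EG : Type*} [NormedAddCommGroup EG] [NormedSpace ℝ EG]
  {HG : Type*} [TopologicalSpace HG] {IG : ModelWithCorners ℝ EG HG}
  {G : Type*} [TopologicalSpace G] [ChartedSpace HG G] [Group G]

/-- The derivative at `x` of `h ↦ a h b`, read in the model vector space. -/
def transDeriv (IG : ModelWithCorners ℝ EG HG) (a b x : G) : EG →L[ℝ] EG :=
  mfderiv IG IG (fun h : G => a * h * b) x

theorem transDeriv_eq_id (a b x : G) (e : (fun h : G => a * h * b) = id) (v : EG) :
    transDeriv IG a b x v = v := by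
  have : transDeriv IG a b x = ContinuousLinearMap.id ℝ EG := by
    unfold transDeriv; rw [e]; exact mfderiv_id
  rw [this]; rfl

theorem lieAd_one (ξ : GroupLieAlgebra IG G) : lieAd IG (1 : G) ξ = ξ :=
  transDeriv_eq_id (IG := IG) (1 : G) 1⁻¹ 1 (by funext h; simp) ξ

/-- The map `X_g ↦ T_g l_{g⁻¹} X_g` from `TG` to `𝔤 = T₁G`. -/
def leftLog (X : TangentBundle IG G) : EG :=
  mfderiv IG IG (fun h : G => X.proj⁻¹ * h) X.proj X.2

theorem leftLog_eq (g : G) (v : EG) :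
    leftLog (IG := IG) ⟨g, v⟩ = transDeriv IG g⁻¹ 1 g v := by
  have e : (fun h : G => g⁻¹ * h) = fun h : G => g⁻¹ * h * 1 := by funext h; simp
  unfold leftLog transDeriv
  exact congrArg (fun f : G → G => (mfderiv IG IG f g : EG →L[ℝ] EG) v) e

theorem mulInvariantVectorField_eq_transDeriv (g : G) (v : EG) :
    @Eq EG (mulInvariantVectorField (I := IG) (G := G) v g) (transDeriv IG g 1 1 v) := by
  have e : (fun h : G => g * h) = fun h : G => g * h * 1 := by funext h; simp
  unfold mulInvariantVectorField transDeriv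
  exact congrArg (fun f : G → G => (mfderiv IG IG f 1 : EG →L[ℝ] EG) v) e

theorem leftLog_of_proj_eq_one (X : TangentBundle IG G) (h : X.proj = 1) : leftLog X = X.2 := by
  obtain ⟨g, v⟩ := X
  obtain rfl : g = 1 := h
  exact (leftLog_eq (IG := IG) 1 v).trans
    (transDeriv_eq_id (IG := IG) _ _ _ (by funext h; simp) v)

theorem leftLog_zero (g : G) : leftLog (IG := IG) ⟨g, (0 : EG)⟩ = 0 := by
  rw [leftLog_eq, map_zero]

variable [LieGroup IG ∞ G]

theorem mdifferentiable_mul_mul (a b : G) : MDifferentiable IG IG (fun h : G => a * h * b) :=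
  (((contMDiff_mul_right (I := IG) (n := ∞) (a := b)).comp
    (contMDiff_mul_left (I := IG) (n := ∞) (a := a)))).mdifferentiable (by simp)

theorem transDeriv_comp (a b c d x : G) (v : EG) :
    transDeriv IG a b (c * x * d) (transDeriv IG c d x v)
      = transDeriv IG (a * c) (d * b) x v := by
  have h := mfderiv_comp (I := IG) (I' := IG) (I'' := IG) x
    (mdifferentiable_mul_mul (IG := IG) a b (c * x * d)) (mdifferentiable_mul_mul (IG := IG) c d x)
  have e : (fun h : G => a * h * b) ∘ (fun h : G => c * h * d)
      = fun h : G => (a * c) * h * (d * b) := by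
    funext h; simp [mul_assoc]
  rw [e] at h
  exact (congrArg (fun L : EG →L[ℝ] EG => L v) h).symm

theorem lieAd_mul (g h : G) (ξ : GroupLieAlgebra IG G) :
    lieAd IG (g * h) ξ = lieAd IG g (lieAd IG h ξ) := by
  have := transDeriv_comp (IG := IG) g g⁻¹ h h⁻¹ 1 ξ
  rw [mul_one, mul_inv_cancel, ← mul_inv_rev] at this
  exact this.symm

namespace TangentGroup

/-- The group structure `(g, ξ) (h, η) = (g h, η + Ad_{h⁻¹} ξ)` on `G × 𝔤`. -/
instance : Group (TangentGroup IG G) where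
  mul k l := TangentGroup.mk (k.base * l.base) (l.vec + lieAd IG l.base⁻¹ k.vec)
  one := TangentGroup.mk 1 0
  inv k := TangentGroup.mk k.base⁻¹ (-(lieAd IG k.base k.vec))
  mul_assoc a b c := by
    refine Prod.ext (mul_assoc a.base b.base c.base) ?_
    change c.vec + lieAd IG c.base⁻¹ (b.vec + lieAd IG b.base⁻¹ a.vec)
      = (c.vec + lieAd IG c.base⁻¹ b.vec) + lieAd IG (b.base * c.base)⁻¹ a.vec
    rw [mul_inv_rev, lieAd_mul, map_add, add_assoc]
  one_mul a := by
    refine Prod.ext (one_mul a.base) ?_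
    change a.vec + lieAd IG a.base⁻¹ 0 = a.vec
    rw [map_zero, add_zero]
  mul_one a := by
    refine Prod.ext (mul_one a.base) ?_
    change 0 + lieAd IG (1 : G)⁻¹ a.vec = a.vec
    rw [inv_one, lieAd_one, zero_add]
  inv_mul_cancel a := by
    refine Prod.ext (inv_mul_cancel a.base) ?_
    change a.vec + lieAd IG a.base⁻¹ (-(lieAd IG a.base a.vec)) = 0
    rw [map_neg, ← lieAd_mul, inv_mul_cancel, lieAd_one, add_neg_cancel]

theorem mk_mul_mk (g h : G) (ξ η : GroupLieAlgebra IG G) :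
    (mk g ξ * mk h η : TangentGroup IG G) = mk (g * h) (η + lieAd IG h⁻¹ ξ) := rfl

variable (IG G) in
/-- The left trivialisation `TG → G × 𝔤`, `X_g ↦ (g, T_g l_{g⁻¹} X_g)`, with inverse
`(g, ξ) ↦ T₁ l_g ξ`. -/
def ofTangentBundle : TangentBundle IG G ≃ TangentGroup IG G where
  toFun X := mk (IG := IG) X.proj (leftLog (EG := EG) X)
  invFun k := ⟨k.base, mulInvariantVectorField k.vec k.base⟩
  left_inv := by
    rintro ⟨g, v : EG⟩
    refine congrArg (TotalSpace.mk g) ?_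
    refine (mulInvariantVectorField_eq_transDeriv (IG := IG) g (leftLog (IG := IG) ⟨g, v⟩)).trans ?_
    rw [leftLog_eq]
    have := transDeriv_comp (IG := IG) g 1 g⁻¹ 1 g v
    rw [inv_mul_cancel, one_mul] at this
    exact this.trans (transDeriv_eq_id (IG := IG) _ _ _ (by funext h; simp) v)
  right_inv := by
    rintro ⟨g, v : EG⟩
    refine Prod.ext rfl ?_
    refine (leftLog_eq (IG := IG) g (mulInvariantVectorField (I := IG) v g : EG)).trans ?_
    refine (congrArg (transDeriv IG g⁻¹ 1 g)
      (mulInvariantVectorField_eq_transDeriv (IG := IG) g v)).trans ?_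
    have := transDeriv_comp (IG := IG) g⁻¹ 1 g 1 1 v
    rw [mul_one, mul_one] at this
    exact this.trans (transDeriv_eq_id (IG := IG) _ _ _ (by funext h; simp) v)

/-- The left trivialisation carries the group structure of `TG`, which is the tangent map of the
multiplication of `G`, to the group structure of `G × 𝔤`. -/
theorem ofTangentBundle_tangentMap_mul (X Y : TangentBundle IG G) :
    ofTangentBundle IG G (tangentMap (IG.prod IG) IG (fun p : G × G => p.1 * p.2)
      ((equivTangentBundleProd IG G IG G).symm (X, Y)))
      = ofTangentBundle IG G X * ofTangentBundle IG G Y := by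
  obtain ⟨g, v : EG⟩ := X
  obtain ⟨h, w : EG⟩ := Y
  refine Prod.ext rfl ?_
  have hd : @Eq EG (mfderiv (IG.prod IG) IG (fun p : G × G => p.1 * p.2) (g, h) (v, w))
      (transDeriv IG 1 h g v + transDeriv IG g 1 h w) := by
    have e1 : (fun x : G => x * h) = fun x : G => 1 * x * h := by funext x; simp
    have e2 : (fun x : G => g * x) = fun x : G => g * x * 1 := by funext x; simp
    refine (mfderiv_prod_eq_add_apply
      ((contMDiff_mul IG ∞).mdifferentiable (by simp) (g, h))).trans ?_
    exact congrArg₂ (fun a b : EG => a + b)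
      (congrArg (fun f : G → G => (mfderiv IG IG f g : EG →L[ℝ] EG) v) e1)
      (congrArg (fun f : G → G => (mfderiv IG IG f h : EG →L[ℝ] EG) w) e2)
  change leftLog (IG := IG)
    ⟨g * h, (mfderiv (IG.prod IG) IG (fun p : G × G => p.1 * p.2) (g, h) (v, w) : EG)⟩ = _
  refine (leftLog_eq (IG := IG) (g * h) _).trans ?_
  refine (congrArg (transDeriv IG (g * h)⁻¹ 1 (g * h)) hd).trans ?_
  change _ = leftLog (IG := IG) ⟨h, w⟩ + transDeriv IG h⁻¹ h⁻¹⁻¹ 1 (leftLog (IG := IG) ⟨g, v⟩)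
  rw [map_add, add_comm, leftLog_eq, leftLog_eq]
  have h1 := transDeriv_comp (IG := IG) (g * h)⁻¹ 1 g 1 h w
  have h2 := transDeriv_comp (IG := IG) (g * h)⁻¹ 1 1 h g v
  have h3 := transDeriv_comp (IG := IG) h⁻¹ h⁻¹⁻¹ g⁻¹ 1 g v
  simp only [mul_one, one_mul, mul_inv_rev, inv_mul_cancel_right, inv_inv,
    inv_mul_cancel] at h1 h2 h3 ⊢
  rw [h1, h2, h3]

theorem contMDiff_vec_of_proj_const {EN HN N : Type*} [NormedAddCommGroup EN] [NormedSpace ℝ EN]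
    [TopologicalSpace HN] {IN : ModelWithCorners ℝ EN HN} [TopologicalSpace N] [ChartedSpace HN N]
    (f : N → TangentBundle IG G) (hf : ContMDiff IN IG.tangent ∞ f) (y : G)
    (hy : ∀ x, (f x).proj = y) : ContMDiff IN 𝓘(ℝ, EG) ∞ (fun x => ((f x).2 : EG)) := by
  intro x
  have h := ((contMDiffAt_totalSpace (f := f) (x₀ := x)).1 (hf x)).2
  refine h.congr_of_eventuallyEq (Filter.Eventually.of_forall fun z => ?_)
  have hz := hy z
  change ((f z).2 : EG) = (trivializationAt EG (TangentSpace IG) (f x).proj (f z)).2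
  rw [hy x]
  generalize f z = w at hz ⊢
  obtain ⟨p, v⟩ := w
  obtain rfl : p = y := hz
  exact (tangentCoordChange_self (I := IG) (mem_extChartAt_source p)).symm

theorem contMDiff_fiber_mk (y : G) :
    ContMDiff 𝓘(ℝ, EG) IG.tangent ∞ (fun v : EG => (⟨y, v⟩ : TangentBundle IG G)) := by
  intro x
  refine (contMDiffAt_totalSpace (F := EG) (E := TangentSpace IG (M := G))).2
    ⟨contMDiffAt_const, contMDiffAt_id.congr_of_eventuallyEq (Filter.Eventually.of_forall fun z => ?_)⟩
  exact tangentCoordChange_self (I := IG) (mem_extChartAt_source y)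

theorem contMDiff_tangentMap_mul : ContMDiff (IG.tangent.prod IG.tangent) IG.tangent ∞
    (fun p : TangentBundle IG G × TangentBundle IG G =>
      tangentMap (IG.prod IG) IG (fun p : G × G => p.1 * p.2)
        ((equivTangentBundleProd IG G IG G).symm p)) :=
  ((contMDiff_mul IG ∞).contMDiff_tangentMap (m := ∞) (by simp)).comp
    contMDiff_equivTangentBundleProd_symm

theorem mk_zero_mul (g : G) (k : TangentGroup IG G) :
    mk g 0 * k = mk (g * k.base) k.vec := by
  refine Prod.ext rfl ?_
  change k.vec + lieAd IG k.base⁻¹ 0 = k.vec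
  rw [map_zero, add_zero]

theorem ofTangentBundle_zero_mul (g : G) (X : TangentBundle IG G) :
    ofTangentBundle IG G (tangentMap (IG.prod IG) IG (fun p : G × G => p.1 * p.2)
      ((equivTangentBundleProd IG G IG G).symm (⟨g, (0 : EG)⟩, X)))
      = mk (IG := IG) (g * X.proj) (leftLog (EG := EG) X) := by
  refine (ofTangentBundle_tangentMap_mul _ _).trans ?_
  have : ofTangentBundle IG G ⟨g, (0 : EG)⟩ = mk g 0 := Prod.ext rfl (leftLog_zero g)
  rw [this]
  exact mk_zero_mul g _

theorem contMDiff_ofTangentBundle_symm :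
    ContMDiff (IG.prod 𝓘(ℝ, EG)) IG.tangent ∞ (ofTangentBundle IG G).symm := by
  have h1 : ContMDiff (IG.prod 𝓘(ℝ, EG)) (IG.tangent.prod IG.tangent) ∞
      (fun k : G × EG => (((⟨k.1, (0 : EG)⟩, ⟨1, k.2⟩) :
        TangentBundle IG G × TangentBundle IG G))) :=
    ((contMDiff_zeroSection ℝ (TangentSpace IG (M := G))).comp contMDiff_fst).prodMk
      ((contMDiff_fiber_mk 1).comp contMDiff_snd)
  refine (contMDiff_tangentMap_mul.comp h1).congr ?_
  intro (k : TangentGroup IG G)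
  apply (ofTangentBundle IG G).injective
  rw [Equiv.apply_symm_apply]
  refine Eq.trans ?_ (ofTangentBundle_zero_mul k.1 ⟨1, k.2⟩).symm
  refine Prod.ext (mul_one k.1).symm ?_
  exact (leftLog_of_proj_eq_one (IG := IG) (⟨1, k.2⟩ : TangentBundle IG G) rfl).symm

theorem contMDiff_ofTangentBundle :
    ContMDiff IG.tangent (IG.prod 𝓘(ℝ, EG)) ∞ (ofTangentBundle IG G) := by
  have h1 : ContMDiff IG.tangent (IG.tangent.prod IG.tangent) ∞
      (fun X : TangentBundle IG G => (((⟨X.proj⁻¹, (0 : EG)⟩, X) :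
        TangentBundle IG G × TangentBundle IG G))) :=
    ((contMDiff_zeroSection ℝ (TangentSpace IG (M := G))).comp
      ((contMDiff_inv IG ∞).comp (contMDiff_proj _))).prodMk contMDiff_id
  have h2 := contMDiff_vec_of_proj_const _ (contMDiff_tangentMap_mul.comp h1) 1
    (fun X => inv_mul_cancel X.proj)
  refine ContMDiff.prodMk (contMDiff_proj _) (h2.congr fun X => ?_)
  have h3 := congrArg (fun k : TangentGroup IG G => (k.2 : EG))
    (ofTangentBundle_zero_mul (IG := IG) X.proj⁻¹ X)
  refine Eq.trans h3.symm ?_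
  exact leftLog_of_proj_eq_one (IG := IG) (tangentMap (IG.prod IG) IG (fun p : G × G => p.1 * p.2)
    ((equivTangentBundleProd IG G IG G).symm (⟨X.proj⁻¹, (0 : EG)⟩, X))) (inv_mul_cancel X.proj)

instance : IsManifold (IG.prod 𝓘(ℝ, EG)) ∞ (TangentGroup IG G) :=
  inferInstanceAs (IsManifold (IG.prod 𝓘(ℝ, EG)) ∞ (G × EG))

theorem contMDiff_mul_aux : ContMDiff ((IG.prod 𝓘(ℝ, EG)).prod (IG.prod 𝓘(ℝ, EG)))
    (IG.prod 𝓘(ℝ, EG)) ∞ (fun p : TangentGroup IG G × TangentGroup IG G => p.1 * p.2) := by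
  refine (contMDiff_ofTangentBundle.comp (contMDiff_tangentMap_mul.comp
    (contMDiff_ofTangentBundle_symm.prodMap contMDiff_ofTangentBundle_symm))).congr fun p => ?_
  refine Eq.trans ?_ (ofTangentBundle_tangentMap_mul _ _).symm
  rw [Equiv.apply_symm_apply, Equiv.apply_symm_apply]

instance : LieGroup (IG.prod 𝓘(ℝ, EG)) ∞ (TangentGroup IG G) where
  contMDiff_mul := contMDiff_mul_aux
  contMDiff_inv := by
    have h1 : ContMDiff (IG.prod 𝓘(ℝ, EG)) (IG.prod 𝓘(ℝ, EG)) ∞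
        (fun k : G × EG => ((1 : G), -k.2)) :=
      contMDiff_const.prodMk contMDiff_snd.neg
    have h2 : ContMDiff (IG.prod 𝓘(ℝ, EG)) (IG.prod 𝓘(ℝ, EG)) ∞
        (fun k : G × EG => (k.1⁻¹, (0 : EG))) :=
      ((contMDiff_inv IG ∞).comp contMDiff_fst).prodMk contMDiff_const
    refine (contMDiff_mul_aux.comp (h1.prodMk h2)).congr fun k : TangentGroup IG G => ?_
    refine inv_eq_of_mul_eq_one_right ?_
    refine Prod.ext ?_ ?_
    · change k.base * (1 * k.base⁻¹) = 1
      simp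
    · change (0 + lieAd IG k.base⁻¹⁻¹ (-k.vec)) + lieAd IG (1 * k.base⁻¹)⁻¹ k.vec = 0
      rw [one_mul, map_neg, zero_add, neg_add_cancel]

end TangentGroup

end TangentGroupGroup

/-! ### Lie group actions on manifolds -/

section Actions

variable {EK : Type*} [NormedAddCommGroup EK] [NormedSpace ℝ EK]
  {HK : Type*} [TopologicalSpace HK] (IK : ModelWithCorners ℝ EK HK)
  {EN : Type*} [NormedAddCommGroup EN] [NormedSpace ℝ EN]
  {HN : Type*} [TopologicalSpace HN] (IN : ModelWithCorners ℝ EN HN)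
  {K : Type*} [TopologicalSpace K] [ChartedSpace HK K] [Group K]
  {N : Type*} [TopologicalSpace N] [ChartedSpace HN N]

/-- `Ψ : K × N → N` is a smooth left action of the Lie group `K` on the manifold `N`. -/
structure IsSmoothAction (Ψ : K → N → N) : Prop where
  one_act : ∀ a, Ψ 1 a = a
  mul_act : ∀ k l a, Ψ (k * l) a = Ψ k (Ψ l a)
  smooth : ContMDiff (IK.prod IN) IN ∞ (fun p : K × N => Ψ p.1 p.2)

/-- The infinitesimal generator `ξ_N` of `ξ ∈ T₁K`: the vector field on `N` whose value at `a` is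
the image of `ξ` under the derivative at `1` of the orbit map `k ↦ Ψ k a`. (The derivative lies in
the tangent space at `Ψ 1 a`, which is `a`.) -/
def infinitesimalGenerator (Ψ : K → N → N) (ξ : GroupLieAlgebra IK K) (a : N) :
    TangentSpace IN a :=
  (mfderiv IK IN (fun k : K => Ψ k a) 1 ξ : EN)

end Actions

/-- The derivative `v(f)` of the function `f` along the tangent vector `v` at `a`. -/
def derivAlong {EN : Type*} [NormedAddCommGroup EN] [NormedSpace ℝ EN]
    {HN : Type*} [TopologicalSpace HN] (IN : ModelWithCorners ℝ EN HN)
    {N : Type*} [TopologicalSpace N] [ChartedSpace HN N]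
    (f : N → ℝ) (a : N) (v : TangentSpace IN a) : ℝ :=
  mfderiv IN 𝓘(ℝ, ℝ) f a v

/-! ### Lie algebroids -/

section LieAlgebroid

variable {EM : Type*} [NormedAddCommGroup EM] [NormedSpace ℝ EM]
  {HM : Type*} [TopologicalSpace HM] (IM : ModelWithCorners ℝ EM HM)
  {M : Type*} [TopologicalSpace M] [ChartedSpace HM M] [IsManifold IM ∞ M]
  (F : Type*) [NormedAddCommGroup F] [NormedSpace ℝ F]
  (A : M → Type*) [TopologicalSpace (TotalSpace F A)] [∀ x, TopologicalSpace (A x)]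
  [∀ x, AddCommGroup (A x)] [∀ x, Module ℝ (A x)] [FiberBundle F A] [VectorBundle ℝ F A]

variable {IM F A} in
/-- The section `f Y`, for a smooth function `f` and a smooth section `Y`. -/
def smulSection (f : C^∞⟮IM, M; ℝ⟯) (Y : Cₛ^∞⟮IM; F, A⟯) : Cₛ^∞⟮IM; F, A⟯ :=
  ⟨fun x => f x • Y x, f.contMDiff.smul_section Y.contMDiff⟩

/-- A Lie algebroid structure on the vector bundle `A → M`: a Lie bracket on the space `Γ(A)` of
smooth sections and an anchor `ρ : A → TM` (a smooth vector bundle map over the identity) such that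
`⟦X, fY⟧ = f ⟦X, Y⟧ + ρ(X)(f) Y`. -/
structure LieAlgebroid where
  bracket : Cₛ^∞⟮IM; F, A⟯ →ₗ[ℝ] Cₛ^∞⟮IM; F, A⟯ →ₗ[ℝ] Cₛ^∞⟮IM; F, A⟯
  bracket_self : ∀ X, bracket X X = 0
  jacobi : ∀ X Y Z,
    bracket X (bracket Y Z) = bracket (bracket X Y) Z + bracket Y (bracket X Z)
  anchor : Cₛ^∞⟮IM; F →L[ℝ] EM, fun x : M => A x →L[ℝ] TangentSpace IM x⟯
  leibniz : ∀ (X Y : Cₛ^∞⟮IM; F, A⟯) (f : C^∞⟮IM, M; ℝ⟯) (x : M),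
    bracket X (smulSection f Y) x
      = f x • bracket X Y x + derivAlong IM f x (anchor x (X x)) • Y x

/-- The smooth sections of the dual bundle `A*`. -/
abbrev DualSection := Cₛ^∞⟮IM; F →L[ℝ] ℝ, fun x : M => A x →L[ℝ] Trivial M ℝ x⟯

variable {IM F A}

/-- The function `α(Y)` on `M`, for `α ∈ Γ(A*)` and `Y ∈ Γ(A)`. -/
def DualSection.pairing (α : DualSection IM F A) (Y : Cₛ^∞⟮IM; F, A⟯) (x : M) : ℝ :=
  α x (Y x)

/-- The linear function `α̂` on the total space of `A` induced by `α ∈ Γ(A*)`. -/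
def DualSection.linearFunction (α : DualSection IM F A) (a : TotalSpace F A) : ℝ :=
  α a.proj a.2

namespace LieAlgebroid

variable (L : LieAlgebroid IM F A)

/-- The differential of `A` on functions: `(d f)(Y) = ρ(Y)(f)`. -/
def dFunction (f : M → ℝ) (Y : Cₛ^∞⟮IM; F, A⟯) (x : M) : ℝ :=
  derivAlong IM f x (L.anchor x (Y x))

/-- The differential of `A` on `Γ(A*)`:
`(d α)(X, Y) = ρ(X)(α(Y)) - ρ(Y)(α(X)) - α(⟦X, Y⟧)`. -/
def dForm (α : DualSection IM F A) (X Y : Cₛ^∞⟮IM; F, A⟯) (x : M) : ℝ :=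
  L.dFunction (α.pairing Y) X x - L.dFunction (α.pairing X) Y x
    - α.pairing (L.bracket X Y) x

/-- The Lie derivative `ℒ_X α = i_X d α + d i_X α`, evaluated on the section `Y`. -/
def lieDerivative (X : Cₛ^∞⟮IM; F, A⟯) (α : DualSection IM F A) (Y : Cₛ^∞⟮IM; F, A⟯) (x : M) : ℝ :=
  L.dForm α X Y x + L.dFunction (α.pairing X) Y x

/-- The vector field `V` on the total space of `A` is the complete lift `Xᶜ` of `X ∈ Γ(A)`: it is
smooth, projects onto the vector field `ρ(X)` on `M`, and maps the linear function `α̂` to the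
linear function of `ℒ_X α`, for every `α ∈ Γ(A*)`. The last identity is tested at the points
`Y(x)`, with `Y ∈ Γ(A)` and `x ∈ M`; these are all the points of `A`. -/
structure IsCompleteLift [ContMDiffVectorBundle ∞ F A IM] (X : Cₛ^∞⟮IM; F, A⟯)
    (V : ∀ a : TotalSpace F A, TangentSpace (IM.prod 𝓘(ℝ, F)) a) : Prop where
  smooth : ContMDiff (IM.prod 𝓘(ℝ, F)) (IM.prod 𝓘(ℝ, F)).tangent ∞
    (fun a => (⟨a, V a⟩ : TangentBundle (IM.prod 𝓘(ℝ, F)) (TotalSpace F A)))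
  projectable : ∀ a : TotalSpace F A,
    mfderiv (IM.prod 𝓘(ℝ, F)) IM (fun b : TotalSpace F A => b.proj) a (V a)
      = L.anchor a.proj (X a.proj)
  linear : ∀ (α : DualSection IM F A) (Y : Cₛ^∞⟮IM; F, A⟯) (x : M),
    derivAlong (IM.prod 𝓘(ℝ, F)) α.linearFunction (⟨x, Y x⟩ : TotalSpace F A) (V ⟨x, Y x⟩)
      = L.lieDerivative X α Y x

end LieAlgebroid

/-- The vertical lift `Xᵛ` of a section `X`: its value at `a ∈ A_x` is the velocity at `t = 0` of
the curve `t ↦ a + t X(x)`. -/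
def verticalLift (X : Cₛ^∞⟮IM; F, A⟯) (a : TotalSpace F A) : TangentSpace (IM.prod 𝓘(ℝ, F)) a :=
  (mfderiv 𝓘(ℝ, ℝ) (IM.prod 𝓘(ℝ, F))
    (fun t : ℝ => (⟨a.proj, a.2 + t • X a.proj⟩ : TotalSpace F A)) 0 (1 : ℝ) : EM × F)

/-! ### Actions on a Lie algebroid -/

section ActionsOnBundles

variable {EK : Type*} [NormedAddCommGroup EK] [NormedSpace ℝ EK]
  {HK : Type*} [TopologicalSpace HK] (IK : ModelWithCorners ℝ EK HK) (IM)
  {K : Type*} [TopologicalSpace K] [ChartedSpace HK K] [Group K]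

/-- A smooth action of `K` on `A` by vector bundle automorphisms: every `Φ k` maps each fibre
linearly to a fibre. -/
structure IsLinearAction (Φ : K → TotalSpace F A → TotalSpace F A) : Prop extends
    IsSmoothAction IK (IM.prod 𝓘(ℝ, F)) Φ where
  fiberwise : ∀ (k : K) (x : M), ∃ (y : M) (T : A x →ₗ[ℝ] A y), ∀ v : A x, Φ k ⟨x, v⟩ = ⟨y, T v⟩

/-- A smooth affine action of `K` on `A`: every `Φ k` maps each fibre to a fibre by an affine
map. -/
structure IsAffineAction (Φ : K → TotalSpace F A → TotalSpace F A) : Prop extends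
    IsSmoothAction IK (IM.prod 𝓘(ℝ, F)) Φ where
  fiberwise : ∀ (k : K) (x : M), ∃ (y : M) (T : A x →ᵃ[ℝ] A y), ∀ v : A x, Φ k ⟨x, v⟩ = ⟨y, T v⟩

end ActionsOnBundles

variable {EG : Type*} [NormedAddCommGroup EG] [NormedSpace ℝ EG]
  {HG : Type*} [TopologicalSpace HG] {IG : ModelWithCorners ℝ EG HG}
  {G : Type*} [TopologicalSpace G] [ChartedSpace HG G] [Group G]

/-- `Φ` is an action of `G` on the Lie algebroid `A` by complete lifts with respect to the linear
map `ψ : 𝔤 → Γ(A)`: it is an action by vector bundle automorphisms, `ψ` is a Lie algebra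
anti-morphism, and the infinitesimal generator of `ξ` is the complete lift of `ψ(ξ)`. -/
structure IsActionByCompleteLifts [ContMDiffVectorBundle ∞ F A IM] (L : LieAlgebroid IM F A)
    (Φ : G → TotalSpace F A → TotalSpace F A)
    (ψ : GroupLieAlgebra IG G →ₗ[ℝ] Cₛ^∞⟮IM; F, A⟯) : Prop extends IsLinearAction IM IG Φ where
  antimorphism : ∀ ξ η : GroupLieAlgebra IG G, ψ ⁅ξ, η⁆ = -L.bracket (ψ ξ) (ψ η)
  generator : ∀ ξ : GroupLieAlgebra IG G,
    L.IsCompleteLift (ψ ξ) (infinitesimalGenerator IG (IM.prod 𝓘(ℝ, F)) Φ ξ)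

/-- The map `Φᵀ((g, ξ), a_x) = Φ_g(a_x + ψ(ξ)(x))`. -/
def inducedAction (Φ : G → TotalSpace F A → TotalSpace F A)
    (ψ : GroupLieAlgebra IG G →ₗ[ℝ] Cₛ^∞⟮IM; F, A⟯)
    (k : TangentGroup IG G) (a : TotalSpace F A) : TotalSpace F A :=
  Φ k.base ⟨a.proj, a.2 + ψ k.vec a.proj⟩

end LieAlgebroid

/-- The element `(ξ, η)` of the Lie algebra `𝔤 × 𝔤` of `G × 𝔤`. -/
def TangentGroup.lieMk {EG : Type*} [NormedAddCommGroup EG] [NormedSpace ℝ EG]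
    {HG : Type*} [TopologicalSpace HG] {IG : ModelWithCorners ℝ EG HG}
    {G : Type*} [TopologicalSpace G] [ChartedSpace HG G] [Group G] [LieGroup IG ∞ G]
    (ξ η : GroupLieAlgebra IG G) :
    GroupLieAlgebra (IG.prod 𝓘(ℝ, EG)) (TangentGroup IG G) :=
  ((ξ, η) : EG × EG)

end

/-! Everything but one point is formal: multiplicativity of `inducedAction` amounts to the
equivariance Φ_g(ψ(ξ)(x)) = ψ(Ad_g ξ)(φ_g x), where φ is the action on the base (`apply_section`).
The hypotheses give only its infinitesimal form, and connectedness of G turns this into the global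
one.

Fix ξ and x. The curve u(g) = Φ_{g⁻¹}(ψ(Ad_g ξ)(φ_g x)) stays in the single vector space A_x, and
equivariance says that it is constant. Its derivative at 1 is found by applying a dual section α to
Φ_g u(g) = ψ(Ad_g ξ)(φ_g x) and differentiating along η. The left side gives (ℒ_{ψ(η)} α)(ψ(ξ)) +
α(u'(η)), since the generator of Φ is the complete lift. The right side gives ρ(ψ(η))(α(ψ(ξ))) +
α(ψ([η, ξ])), since the derivative of Ad is the bracket. As ψ reverses brackets, the formula for ℒ
leaves α(u'(η)) = 0, and dual sections separate vectors. At another point h the derivative vanishes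
because right translation by h⁻¹ turns u into the curve of the same kind for Ad_h ξ and φ_h x.

Three general facts carry this: the derivative of Ad at 1 is the bracket of left-invariant fields
(`mfderiv_adjointOrbit`), obtained from second derivatives of the multiplication in a chart; a map
with zero derivative on a connected manifold is constant (`eq_of_mfderiv_eq_zero`); and smooth
sections with prescribed values exist (`exists_contMDiffSection_apply_eq`).

The generator formula needs no equivariance: the derivative at (1, 0) is the sum of its two partial
derivatives. -/

open Bundle
open scoped Manifold ContDiff

noncomputable section

/-! ### The derivative of the adjoint representation is the Lie bracket. -/

section AdjointDerivative

open Set Filter Topology VectorField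

variable {EG : Type*} [NormedAddCommGroup EG] [NormedSpace ℝ EG]
  {HG : Type*} [TopologicalSpace HG] {IG : ModelWithCorners ℝ EG HG}
  {G : Type*} [TopologicalSpace G] [ChartedSpace HG G] [Group G] [LieGroup IG ∞ G]

/-- The adjoint orbit map `g ↦ Ad_g ξ`, with values in the model vector space. -/
def adjointOrbit (ξ : GroupLieAlgebra IG G) (g : G) : EG := lieAd IG g ξ

/-- Ad_g ξ is the Lie algebra component of the product (g, ξ)(g⁻¹, 0), so smoothness is inherited
from the multiplication of G × 𝔤. -/
theorem contMDiff_adjointOrbit (ξ : GroupLieAlgebra IG G) :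
    ContMDiff IG 𝓘(ℝ, EG) ∞ (adjointOrbit (IG := IG) ξ) := by
  have h1 : ContMDiff IG ((IG.prod 𝓘(ℝ, EG)).prod (IG.prod 𝓘(ℝ, EG))) ∞
      (fun g : G => ((TangentGroup.mk g ξ, TangentGroup.mk g⁻¹ 0) :
        TangentGroup IG G × TangentGroup IG G)) :=
    ((contMDiff_id.prodMk contMDiff_const).prodMk
      ((contMDiff_inv IG ∞).prodMk contMDiff_const))
  have h2 := (contMDiff_snd (I := IG) (J := 𝓘(ℝ, EG)) (M := G) (N := EG) (n := ∞)).comp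
    (TangentGroup.contMDiff_mul_aux.comp h1)
  refine h2.congr fun g => ?_
  change (lieAd IG g ξ : EG) = (0 + lieAd IG (g⁻¹)⁻¹ ξ : GroupLieAlgebra IG G)
  rw [inv_inv, zero_add]

variable (IG G) in
/-- The multiplication of a Lie group read in the preferred chart at the identity. -/
def chartMul (p : EG × EG) : EG :=
  extChartAt IG (1 : G)
    ((extChartAt IG (1 : G)).symm p.1 * (extChartAt IG (1 : G)).symm p.2)

variable [IG.Boundaryless]

theorem mdifferentiableAt_extChartAt_symm {x : EG} (hx : x ∈ (extChartAt IG (1 : G)).target) :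
    MDifferentiableAt 𝓘(ℝ, EG) IG (extChartAt IG (1 : G)).symm x := by
  have : IsManifold IG 1 G := IsManifold.of_le (n := ∞) (by simp)
  have := mdifferentiableWithinAt_extChartAt_symm hx
  rwa [IG.range_eq_univ, mdifferentiableWithinAt_univ] at this

theorem mfderiv_extChartAt_symm_self :
    mfderiv 𝓘(ℝ, EG) IG (extChartAt IG (1 : G)).symm (extChartAt IG (1 : G) 1)
      = ContinuousLinearMap.id ℝ EG := by
  have : IsManifold IG 1 G := IsManifold.of_le (n := ∞) (by simp)
  have := mfderivWithin_range_extChartAt_symm (I := IG) (x := (1 : G))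
  rwa [IG.range_eq_univ, mfderivWithin_univ] at this

theorem contDiffAt_chartMul :
    ContDiffAt ℝ ∞ (chartMul IG G) (extChartAt IG (1 : G) 1, extChartAt IG (1 : G) 1) := by
  have hs : ContMDiffAt 𝓘(ℝ, EG) IG ∞ (extChartAt IG (1 : G)).symm (extChartAt IG (1 : G) 1) :=
    (contMDiffOn_extChartAt_symm (n := ∞) (1 : G)).contMDiffAt
      (extChartAt_target_mem_nhds (1 : G))
  have h1 : ContMDiffAt (𝓘(ℝ, EG).prod 𝓘(ℝ, EG)) IG ∞
      (fun p : EG × EG => (extChartAt IG (1 : G)).symm p.1 * (extChartAt IG (1 : G)).symm p.2)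
      (extChartAt IG (1 : G) 1, extChartAt IG (1 : G) 1) :=
    ContMDiffAt.mul (I := IG) (hs.comp (I' := 𝓘(ℝ, EG)) (_, _) contMDiffAt_fst)
      (hs.comp (I' := 𝓘(ℝ, EG)) (_, _) contMDiffAt_snd)
  have h2 : ContMDiffAt IG 𝓘(ℝ, EG) ∞ (extChartAt IG (1 : G))
      ((extChartAt IG (1 : G)).symm (extChartAt IG (1 : G) 1)
        * (extChartAt IG (1 : G)).symm (extChartAt IG (1 : G) 1)) := by
    rw [extChartAt_to_inv, mul_one]
    exact contMDiffAt_extChartAt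
  have h3 : ContMDiffAt (𝓘(ℝ, EG).prod 𝓘(ℝ, EG)) 𝓘(ℝ, EG) ∞ _
      (extChartAt IG (1 : G) 1, extChartAt IG (1 : G) 1) := ContMDiffAt.comp (I' := IG) (_, _) h2 h1
  rw [← modelWithCornersSelf_prod, chartedSpaceSelf_prod] at h3
  exact h3.contDiffAt

/-- The left-invariant vector field of `v`, read in the chart at the identity, is the partial
derivative of the multiplication along the second variable. -/
theorem mpullbackWithin_mulInvariantVectorField_eventuallyEq (v : GroupLieAlgebra IG G) :
    (mpullbackWithin 𝓘(ℝ, EG) IG (extChartAt IG (1 : G)).symm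
      (mulInvariantVectorField v) (range IG) : EG → EG) =ᶠ[𝓝 (extChartAt IG (1 : G) 1)]
    fun x => fderiv ℝ (fun y => chartMul IG G (x, y)) (extChartAt IG (1 : G) 1) v := by
  have : IsManifold IG 1 G := IsManifold.of_le (n := ∞) (by simp)
  filter_upwards [extChartAt_target_mem_nhds (I := IG) (1 : G)] with x hx
  set c := extChartAt IG (1 : G) with hc
  -- Pulling back by `c.symm` applies the inverse of its derivative, which is the derivative of `c`.
  -- The claim is then the chain rule for c ∘ l_g ∘ c⁻¹ with g = c⁻¹(x).
  have hinv : (mfderivWithin 𝓘(ℝ, EG) IG c.symm (range IG) x).inverse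
      = mfderiv IG 𝓘(ℝ, EG) c (c.symm x) :=
    ContinuousLinearMap.inverse_eq
      (mfderivWithin_extChartAt_symm_comp_mfderiv_extChartAt hx)
      (mfderiv_extChartAt_comp_mfderivWithin_extChartAt_symm hx)
  have hsrc : c.symm x ∈ (chartAt HG (1 : G)).source := by
    rw [← extChartAt_source IG]; exact c.map_target hx
  have h1 : MDifferentiableAt 𝓘(ℝ, EG) IG c.symm (c 1) :=
    mdifferentiableAt_extChartAt_symm (mem_extChartAt_target (1 : G))
  have h2 : MDifferentiableAt IG IG (fun h : G => c.symm x * h) (1 : G) :=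
    (contMDiff_mul_left (I := IG) (n := ∞) (a := c.symm x)).mdifferentiable (by simp) 1
  have h3 : MDifferentiableAt IG 𝓘(ℝ, EG) c (c.symm x) := mdifferentiableAt_extChartAt hsrc
  have e1 : c.symm (c 1) = 1 := extChartAt_to_inv (1 : G)
  have h23 : MDifferentiableAt IG 𝓘(ℝ, EG) (c ∘ fun h : G => c.symm x * h) (1 : G) :=
    MDifferentiableAt.comp_of_eq _ h3 h2 (mul_one _)
  have key := mfderiv_comp_apply_of_eq (I := 𝓘(ℝ, EG)) (I' := IG) (I'' := 𝓘(ℝ, EG)) _ h23 h1 e1 v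
  have key2 := mfderiv_comp_apply_of_eq (I := IG) (I' := IG) (I'' := 𝓘(ℝ, EG)) _ h3 h2
    (mul_one _) v
  rw [mpullbackWithin_apply, hinv, ← mfderiv_eq_fderiv]
  refine Eq.trans ?_ key.symm
  rw [mfderiv_extChartAt_symm_self]
  exact key2.symm

omit [LieGroup IG ∞ G] [IG.Boundaryless] in
theorem fderiv_chartMul_snd {x y : EG} (h : DifferentiableAt ℝ (chartMul IG G) (x, y)) (v : EG) :
    fderiv ℝ (fun y => chartMul IG G (x, y)) y v = fderiv ℝ (chartMul IG G) (x, y) (0, v) := by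
  have := HasFDerivAt.comp (f := fun y => (x, y)) y h.hasFDerivAt (hasFDerivAt_prodMk_right x y)
  rw [show (fun y => chartMul IG G (x, y)) = chartMul IG G ∘ fun y => (x, y) from rfl, this.fderiv]
  simp

omit [LieGroup IG ∞ G] [IG.Boundaryless] in
theorem fderiv_chartMul_fst {x y : EG} (h : DifferentiableAt ℝ (chartMul IG G) (x, y)) (v : EG) :
    fderiv ℝ (fun x => chartMul IG G (x, y)) x v = fderiv ℝ (chartMul IG G) (x, y) (v, 0) := by
  have := HasFDerivAt.comp (f := fun x => (x, y)) x h.hasFDerivAt (hasFDerivAt_prodMk_left x y)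
  rw [show (fun x => chartMul IG G (x, y)) = chartMul IG G ∘ fun x => (x, y) from rfl, this.fderiv]
  simp

theorem eventually_differentiableAt_chartMul :
    ∀ᶠ p in 𝓝 (extChartAt IG (1 : G) 1, extChartAt IG (1 : G) 1),
      DifferentiableAt ℝ (chartMul IG G) p := by
  have h : ContDiffAt ℝ 1 (chartMul IG G)
      (extChartAt IG (1 : G) 1, extChartAt IG (1 : G) 1) := contDiffAt_chartMul.of_le (by simp)
  exact (h.eventually (by simp)).mono fun p hp => hp.differentiableAt (by simp)

theorem hasFDerivAt_fderiv_chartMul :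
    HasFDerivAt (fderiv ℝ (chartMul IG G))
      (fderiv ℝ (fderiv ℝ (chartMul IG G)) (extChartAt IG (1 : G) 1, extChartAt IG (1 : G) 1))
      (extChartAt IG (1 : G) 1, extChartAt IG (1 : G) 1) :=
  ((contDiffAt_chartMul.fderiv_right (m := 1) (by norm_cast)).differentiableAt
    (by simp)).hasFDerivAt

/-- With m the multiplication in the chart and e the image of 1, the field of w reads x ↦ Dm(x,
e)(0, w) near e. Only the base point depends on x, so differentiating yields one mixed second
derivative of m. -/
theorem fderiv_chart_mulInvariantVectorField (v w : EG) :
    fderiv ℝ (mpullbackWithin 𝓘(ℝ, EG) IG (extChartAt IG (1 : G)).symm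
      (mulInvariantVectorField (I := IG) (G := G) w) (range IG) : EG → EG)
      (extChartAt IG (1 : G) 1) v
      = fderiv ℝ (fderiv ℝ (chartMul IG G))
        (extChartAt IG (1 : G) 1, extChartAt IG (1 : G) 1) (v, 0) (0, w) := by
  have h1 := mpullbackWithin_mulInvariantVectorField_eventuallyEq (IG := IG) (G := G) w
  have h2 : ∀ᶠ x in 𝓝 (extChartAt IG (1 : G) 1),
      fderiv ℝ (fun y => chartMul IG G (x, y)) (extChartAt IG (1 : G) 1) w
        = fderiv ℝ (chartMul IG G) (x, extChartAt IG (1 : G) 1) (0, w) := by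
    have hc : ContinuousAt (fun x : EG => (x, extChartAt IG (1 : G) 1))
      (extChartAt IG (1 : G) 1) := by fun_prop
    exact (hc.eventually eventually_differentiableAt_chartMul).mono
      fun x hx => fderiv_chartMul_snd hx _
  rw [(h1.trans h2).fderiv_eq]
  have h3 := HasFDerivAt.comp (f := fun x => (x, extChartAt IG (1 : G) 1)) (extChartAt IG (1 : G) 1)
    (hasFDerivAt_fderiv_chartMul (IG := IG) (G := G)) (hasFDerivAt_prodMk_left (𝕜 := ℝ) (extChartAt IG (1 : G) 1) (extChartAt IG (1 : G) 1))
  have h4 := h3.clm_apply (hasFDerivAt_const ((0 : EG), w) (extChartAt IG (1 : G) 1))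
  refine (congrArg (fun L : EG →L[ℝ] EG => L v) h4.fderiv).trans ?_
  rw [add_apply, ContinuousLinearMap.comp_zero]
  simp

/-- The Lie bracket of a Lie group in terms of the second derivative of the multiplication. -/
theorem lie_eq_fderiv_fderiv_chartMul (v w : EG) :
    @Eq EG (Bracket.bracket (L := GroupLieAlgebra IG G) (M := GroupLieAlgebra IG G) v w) (fderiv ℝ (fderiv ℝ (chartMul IG G))
        (extChartAt IG (1 : G) 1, extChartAt IG (1 : G) 1) (v, 0) (0, w)
      - fderiv ℝ (fderiv ℝ (chartMul IG G))
        (extChartAt IG (1 : G) 1, extChartAt IG (1 : G) 1) (w, 0) (0, v)) := by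
  have : IsManifold IG 1 G := IsManifold.of_le (n := ∞) (by simp)
  have hval : ∀ u : EG, @Eq EG (mpullbackWithin 𝓘(ℝ, EG) IG
      (extChartAt IG (1 : G)).symm (mulInvariantVectorField (I := IG) (G := G) u) (range IG)
      (extChartAt IG (1 : G) 1)) u := by
    intro u
    rw [mpullbackWithin_apply, IG.range_eq_univ, mfderivWithin_univ,
      mfderiv_extChartAt_symm_self]
    have : ∀ g : G, g = 1 → @Eq EG (mulInvariantVectorField (I := IG) (G := G) u g) u := by
      rintro g rfl
      exact (mulInvariantVectorField_eq_transDeriv (IG := IG) 1 u).trans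
        (transDeriv_eq_id _ _ _ (by funext h; simp) _)
    refine Eq.trans ?_ (this _ (extChartAt_to_inv (I := IG) (1 : G)))
    exact congrArg (fun L : EG →L[ℝ] EG => L _) (ContinuousLinearMap.inverse_id (R := ℝ) (M := EG))
  rw [← fderiv_chart_mulInvariantVectorField, ← fderiv_chart_mulInvariantVectorField]
  -- The manifold bracket is the vector space bracket DW(V) − DV(W) of the fields read in the chart
  -- at 1, carried back by the derivative of the chart at 1, which is the identity.
  refine Eq.trans (b := ((mfderiv IG 𝓘(ℝ, EG) (extChartAt IG (1 : G)) 1).inverse _ : EG))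
    (mlieBracketWithin_apply (I := IG) (s := univ) (x₀ := (1 : G))
      (V := mulInvariantVectorField (I := IG) (G := G) v)
      (W := mulInvariantVectorField (I := IG) (G := G) w)) ?_
  rw [mfderiv_extChartAt_self]
  refine (congrArg (fun L : EG →L[ℝ] EG => L _)
    (ContinuousLinearMap.inverse_id (R := ℝ) (M := EG))).trans ?_
  have hu : ((extChartAt IG (1 : G)).symm ⁻¹' univ ∩ range IG : Set EG) = univ := by
    rw [preimage_univ, univ_inter, IG.range_eq_univ]
  rw [hu]
  refine (congrFun (lieBracketWithin_univ (𝕜 := ℝ) (E := EG)) _).trans ?_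
  exact congrArg₂ (fun a b : EG => fderiv ℝ (mpullbackWithin 𝓘(ℝ, EG) IG
      (extChartAt IG (1 : G)).symm (mulInvariantVectorField (I := IG) (G := G) w) (range IG) :
        EG → EG) (extChartAt IG (1 : G) 1) a
    - fderiv ℝ (mpullbackWithin 𝓘(ℝ, EG) IG
      (extChartAt IG (1 : G)).symm (mulInvariantVectorField (I := IG) (G := G) v) (range IG) :
        EG → EG) (extChartAt IG (1 : G) 1) b) (hval v) (hval w)

/-- Conjugation moves left translations to right translations: `T r_g (Ad_g w) = T l_g w`, read
in the chart at the identity. -/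
theorem eventually_fderiv_chartMul_lieAd (w : EG) :
    ∀ᶠ x in 𝓝 (extChartAt IG (1 : G) 1),
      fderiv ℝ (chartMul IG G) (extChartAt IG (1 : G) 1, x)
        (adjointOrbit (IG := IG) (G := G) w ((extChartAt IG (1 : G)).symm x), 0)
      = fderiv ℝ (chartMul IG G) (x, extChartAt IG (1 : G) 1) (0, w) := by
  have : IsManifold IG 1 G := IsManifold.of_le (n := ∞) (by simp)
  have hc1 : ContinuousAt (fun x : EG => (x, extChartAt IG (1 : G) 1))
    (extChartAt IG (1 : G) 1) := by fun_prop
  have hc2 : ContinuousAt (fun x : EG => (extChartAt IG (1 : G) 1, x))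
    (extChartAt IG (1 : G) 1) := by fun_prop
  filter_upwards [extChartAt_target_mem_nhds (I := IG) (1 : G),
    hc1.eventually eventually_differentiableAt_chartMul,
    hc2.eventually eventually_differentiableAt_chartMul] with x hx hd1 hd2
  set c := extChartAt IG (1 : G) with hc
  set g := c.symm x with hg
  have hsrc : g ∈ (chartAt HG (1 : G)).source := by
    rw [← extChartAt_source IG]; exact c.map_target hx
  have e1 : c.symm (c 1) = 1 := extChartAt_to_inv (1 : G)
  have hs : MDifferentiableAt 𝓘(ℝ, EG) IG c.symm (c 1) :=
    mdifferentiableAt_extChartAt_symm (mem_extChartAt_target (1 : G))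
  have h3 : MDifferentiableAt IG 𝓘(ℝ, EG) c g := mdifferentiableAt_extChartAt hsrc
  have hr : MDifferentiableAt IG IG (fun h : G => h * g) (1 : G) :=
    (contMDiff_mul_right (I := IG) (n := ∞) (a := g)).mdifferentiable (by simp) 1
  have hl : MDifferentiableAt IG IG (fun h : G => g * h) (1 : G) :=
    (contMDiff_mul_left (I := IG) (n := ∞) (a := g)).mdifferentiable (by simp) 1
  have hconj : MDifferentiableAt IG IG (fun h : G => g * h * g⁻¹) (1 : G) :=
    mdifferentiable_mul_mul g g⁻¹ 1
  have hcr : MDifferentiableAt IG 𝓘(ℝ, EG) (c ∘ fun h : G => h * g) (1 : G) :=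
    MDifferentiableAt.comp_of_eq _ h3 hr (one_mul _)
  have hcl : MDifferentiableAt IG 𝓘(ℝ, EG) (c ∘ fun h : G => g * h) (1 : G) :=
    MDifferentiableAt.comp_of_eq _ h3 hl (mul_one _)
  have kl := mfderiv_comp_apply_of_eq (I := 𝓘(ℝ, EG)) (I' := IG) (I'' := 𝓘(ℝ, EG)) _ hcl hs e1 w
  have kr := mfderiv_comp_apply_of_eq (I := 𝓘(ℝ, EG)) (I' := IG) (I'' := 𝓘(ℝ, EG)) _ hcr hs e1
    (lieAd IG g w : EG)
  have kc := mfderiv_comp_apply_of_eq (I := IG) (I' := IG) (I'' := 𝓘(ℝ, EG)) _ hcr hconj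
    (by simp) w
  -- Conjugation by g followed by right translation by g is left translation by g.
  have ec : (c ∘ fun h : G => h * g) ∘ (fun h : G => g * h * g⁻¹) = c ∘ fun h : G => g * h := by
    funext h; simp
  rw [ec] at kc
  rw [mfderiv_extChartAt_symm_self] at kl kr
  rw [← fderiv_chartMul_fst hd2, ← fderiv_chartMul_snd hd1, ← mfderiv_eq_fderiv,
    ← mfderiv_eq_fderiv]
  exact (kr.trans kc.symm).trans kl.symm

/-- The derivative of the adjoint representation at the identity is the Lie bracket. -/
theorem mfderiv_adjointOrbit (v w : EG) :
    @Eq EG (mfderiv IG 𝓘(ℝ, EG) (adjointOrbit (IG := IG) (G := G) w) 1 v)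
      (Bracket.bracket (L := GroupLieAlgebra IG G) (M := GroupLieAlgebra IG G) v w) := by
  have : IsManifold IG 1 G := IsManifold.of_le (n := ∞) (by simp)
  set c := extChartAt IG (1 : G) with hc
  set a : EG → EG := fun x => adjointOrbit (IG := IG) (G := G) w (c.symm x) with ha
  have e1 : c.symm (c 1) = 1 := extChartAt_to_inv (1 : G)
  have hs : MDifferentiableAt 𝓘(ℝ, EG) IG c.symm (c 1) :=
    mdifferentiableAt_extChartAt_symm (mem_extChartAt_target (1 : G))
  have hAd : MDifferentiableAt IG 𝓘(ℝ, EG) (adjointOrbit (IG := IG) (G := G) w) (1 : G) :=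
    (contMDiff_adjointOrbit w).mdifferentiable (by simp) 1
  have hda : DifferentiableAt ℝ a (c 1) :=
    (MDifferentiableAt.comp_of_eq _ hAd hs e1).differentiableAt
  have hfa : @Eq EG (mfderiv IG 𝓘(ℝ, EG) (adjointOrbit (IG := IG) (G := G) w) 1 v)
      (fderiv ℝ a (c 1) v) := by
    have := mfderiv_comp_apply_of_eq (I := 𝓘(ℝ, EG)) (I' := IG) (I'' := 𝓘(ℝ, EG)) _ hAd hs e1 v
    rw [mfderiv_extChartAt_symm_self] at this
    rw [← mfderiv_eq_fderiv]
    exact this.symm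
  have ha0 : a (c 1) = w := by
    simp only [ha, e1]; exact lieAd_one w
  have hD := hasFDerivAt_fderiv_chartMul (IG := IG) (G := G)
  rw [← hc] at hD
  -- Differentiate Dm(e, x)(a(x), 0) = Dm(x, e)(0, w) at x = e along v. The left side, by the
  -- product rule, gives D²m((0, v), (w, 0)) + Dm(e, e)(a'(v), 0); the right side gives D²m((v, 0),
  -- (0, w)).
  have hQ := (HasFDerivAt.comp (f := fun x => (c 1, x)) (c 1) hD (hasFDerivAt_prodMk_right (𝕜 := ℝ) (c 1) (c 1))).clm_apply
    (hda.hasFDerivAt.prodMk (hasFDerivAt_const (0 : EG) (c 1)))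
  have hP := (HasFDerivAt.comp (f := fun x => (x, c 1)) (c 1) hD (hasFDerivAt_prodMk_left (𝕜 := ℝ) (c 1) (c 1))).clm_apply
    (hasFDerivAt_const ((0 : EG), w) (c 1))
  have hPQ := Filter.EventuallyEq.fderiv_eq (𝕜 := ℝ)
    (eventually_fderiv_chartMul_lieAd (IG := IG) (G := G) w)
  have hmain := congrArg (fun L : EG →L[ℝ] EG => L v) ((hQ.fderiv.symm.trans hPQ).trans hP.fderiv)
  -- Since e is a right unit, m(x, e) = x near e; hence the term containing a'(v) is a'(v) itself.
  have hid : ∀ u : EG, fderiv ℝ (chartMul IG G) (c 1, c 1) (u, 0) = u := by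
    intro u
    rw [← fderiv_chartMul_fst eventually_differentiableAt_chartMul.self_of_nhds]
    have : (fun x => chartMul IG G (x, c 1)) =ᶠ[𝓝 (c 1)] id := by
      filter_upwards [extChartAt_target_mem_nhds (I := IG) (1 : G)] with x hx
      simp only [chartMul, ← hc, e1, mul_one, id]
      exact c.right_inv hx
    rw [this.fderiv_eq, fderiv_id]; rfl
  -- Symmetry turns D²m((0, v), (w, 0)) into the second term of the bracket formula.
  have hsymm : IsSymmSndFDerivAt ℝ (chartMul IG G) (c 1, c 1) :=
    contDiffAt_chartMul.isSymmSndFDerivAt (by simp; norm_cast)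
  refine hfa.trans (Eq.trans ?_ (lie_eq_fderiv_fderiv_chartMul v w).symm)
  rw [add_apply, add_apply, ContinuousLinearMap.comp_zero] at hmain
  simp only [ContinuousLinearMap.comp_apply, ContinuousLinearMap.flip_apply, Function.comp_apply,
    ContinuousLinearMap.prod_apply, zero_apply, ContinuousLinearMap.inl_apply,
    ContinuousLinearMap.inr_apply, zero_add, hid, ha0] at hmain
  rw [← hc, ← hmain, hsymm (w, 0) (0, v), add_sub_cancel_right]

end AdjointDerivative

/-! ### Maps with vanishing derivative on a connected manifold. -/

section ConstantOfDerivative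

open Set Filter Topology

/-- A smooth map from a connected boundaryless manifold to a normed space whose derivative vanishes
is constant. -/
theorem eq_of_mfderiv_eq_zero {EK : Type*} [NormedAddCommGroup EK] [NormedSpace ℝ EK]
    {HK : Type*} [TopologicalSpace HK] {IK : ModelWithCorners ℝ EK HK} [IK.Boundaryless]
    {K : Type*} [TopologicalSpace K] [ChartedSpace HK K] [IsManifold IK 1 K]
    [PreconnectedSpace K] {E : Type*} [NormedAddCommGroup E] [NormedSpace ℝ E] {f : K → E}
    (hf : MDifferentiable IK 𝓘(ℝ, E) f) (h : ∀ x, mfderiv IK 𝓘(ℝ, E) f x = 0) (x y : K) :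
    f x = f y := by
  refine IsLocallyConstant.apply_eq_of_preconnectedSpace ?_ x y
  refine (IsLocallyConstant.iff_eventually_eq f).2 fun x => ?_
  set c := extChartAt IK x with hc
  -- Without boundary the chart's target contains a ball around the image of x; a ball is convex, so
  -- zero derivative forces the chart expression to be constant on it.
  obtain ⟨r, hr, hball⟩ := Metric.mem_nhds_iff.1 (extChartAt_target_mem_nhds (I := IK) x)
  have hs : ∀ z ∈ c.target, MDifferentiableAt 𝓘(ℝ, EK) IK c.symm z := by
    intro z hz
    have := mdifferentiableWithinAt_extChartAt_symm hz
    rwa [IK.range_eq_univ, mdifferentiableWithinAt_univ] at this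
  have hd : ∀ z ∈ c.target, DifferentiableAt ℝ (f ∘ c.symm) z := fun z hz =>
    (MDifferentiableAt.comp z (hf _) (hs z hz)).differentiableAt
  have h0 : ∀ z ∈ c.target, fderiv ℝ (f ∘ c.symm) z = 0 := by
    intro z hz
    rw [← mfderiv_eq_fderiv, mfderiv_comp z (hf _) (hs z hz), h]
    rfl
  have hconst : ∀ z ∈ Metric.ball (c x) r, (f ∘ c.symm) z = (f ∘ c.symm) (c x) := by
    intro z hz
    refine (convex_ball (c x) r).is_const_of_fderivWithin_eq_zero (𝕜 := ℝ)
      (fun w hw => (hd w (hball hw)).differentiableWithinAt) (fun w hw => ?_) hz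
      (Metric.mem_ball_self hr)
    rw [fderivWithin_of_isOpen Metric.isOpen_ball hw]
    exact h0 w (hball hw)
  filter_upwards [extChartAt_source_mem_nhds (I := IK) x,
    (continuousAt_extChartAt (I := IK) x).preimage_mem_nhds (Metric.ball_mem_nhds _ hr)] with y hy1 hy2
  have := hconst (c y) hy2
  rwa [Function.comp_apply, Function.comp_apply, c.left_inv hy1,
    c.left_inv (mem_extChartAt_source x)] at this

end ConstantOfDerivative

/-! ### Smooth sections: existence, separation, and dependence on a linear parameter. -/

section Sections

variable {EM : Type*} [NormedAddCommGroup EM] [NormedSpace ℝ EM]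
  {HM : Type*} [TopologicalSpace HM] {IM : ModelWithCorners ℝ EM HM}
  {M : Type*} [TopologicalSpace M] [ChartedSpace HM M]
  {F : Type*} [NormedAddCommGroup F] [NormedSpace ℝ F]
  {A : M → Type*} [TopologicalSpace (TotalSpace F A)] [∀ x, TopologicalSpace (A x)]
  [∀ x, AddCommGroup (A x)] [∀ x, Module ℝ (A x)] [FiberBundle F A] [VectorBundle ℝ F A]

/-- Every vector of a smooth vector bundle is the value of a smooth section. -/
theorem exists_contMDiffSection_apply_eq [FiniteDimensional ℝ EM] [T2Space M] [IsManifold IM ∞ M]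
    [ContMDiffVectorBundle ∞ F A IM] {x : M} (v : A x) : ∃ s : Cₛ^∞⟮IM; F, A⟯, s x = v := by
  obtain ⟨u, hu, hs⟩ := FiberBundle.exists_contMDiffOn_extend (k := ∞) IM F v
  obtain ⟨t, htu, hto, hxt⟩ := mem_nhds_iff.1 hu
  -- The local extension is smooth only near x. A bump function supported there and equal to 1 at x
  -- makes it global without changing its value at x.
  obtain ⟨f, -, hft⟩ := (SmoothBumpFunction.nhds_basis_tsupport (I := IM) x).mem_iff.1
    (hto.mem_nhds hxt)
  refine ⟨⟨fun y => f y • FiberBundle.extend F v y,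
    ContMDiffOn.smul_section_of_tsupport f.contMDiff.contMDiffOn hto hft (hs.mono htu)⟩, ?_⟩
  change f x • FiberBundle.extend F v x = v
  rw [f.eq_one, one_smul, FiberBundle.extend_apply_self]

/-- The smooth sections of the dual bundle separate the vectors of a vector bundle. -/
theorem eq_zero_of_forall_dualSection [FiniteDimensional ℝ EM] [T2Space M] [IsManifold IM ∞ M]
    [ContMDiffVectorBundle ∞ F A IM] {x : M} {v : A x}
    (h : ∀ α : DualSection IM F A, α x v = 0) : v = 0 := by
  set e := (trivializationAt F A x).continuousLinearEquivAt ℝ x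
    (FiberBundle.mem_baseSet_trivializationAt' x) with he
  refine e.injective ?_
  rw [map_zero]
  -- Functionals on the model fibre separate points, and each of them, moved to the fibre over x, is
  -- the value of a global dual section.
  refine SeparatingDual.eq_zero_of_forall_dual_eq_zero (R := ℝ) fun l => ?_
  obtain ⟨α, hα⟩ := exists_contMDiffSection_apply_eq (IM := IM) (F := F →L[ℝ] ℝ)
    (A := fun x : M => A x →L[ℝ] Trivial M ℝ x) (x := x) (l ∘L (e : A x →L[ℝ] F))
  have := h α
  rw [hα] at this
  exact this

theorem DualSection.contMDiff_linearFunction [ContMDiffVectorBundle ∞ F A IM]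
    (α : DualSection IM F A) :
    ContMDiff (IM.prod 𝓘(ℝ, F)) 𝓘(ℝ, ℝ) ∞ α.linearFunction := by
  have h1 : ContMDiff (IM.prod 𝓘(ℝ, F)) (IM.prod 𝓘(ℝ, ℝ)) ∞
      (fun a : TotalSpace F A => TotalSpace.mk' ℝ (E := Trivial M ℝ) a.proj (α a.proj a.2)) :=
    ContMDiff.clm_bundle_apply (F₁ := F) (E₁ := A) (F₂ := ℝ) (E₂ := Trivial M ℝ)
      (b := fun a : TotalSpace F A => a.proj) (ϕ := fun a => α a.proj) (v := fun a => a.2)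
      (α.contMDiff.comp (contMDiff_proj A)) contMDiff_id
  intro a
  exact (contMDiffAt_totalSpace.1 (h1 a)).2

/-- Evaluation of smooth sections at a point. -/
def evalSection (IM : ModelWithCorners ℝ EM HM) (F : Type*) [NormedAddCommGroup F] [NormedSpace ℝ F]
    (A : M → Type*) [TopologicalSpace (TotalSpace F A)] [∀ x, TopologicalSpace (A x)]
    [∀ x, AddCommGroup (A x)] [∀ x, Module ℝ (A x)] [FiberBundle F A] [VectorBundle ℝ F A]
    (x : M) : Cₛ^∞⟮IM; F, A⟯ →ₗ[ℝ] A x where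
  toFun s := s x
  map_add' _ _ := rfl
  map_smul' _ _ := rfl

/-- Translation by sections depending linearly on a parameter is smooth. -/
theorem contMDiff_add_linear_section [ContMDiffVectorBundle ∞ F A IM]
    {E : Type*} [NormedAddCommGroup E] [NormedSpace ℝ E] [FiniteDimensional ℝ E]
    {EN : Type*} [NormedAddCommGroup EN] [NormedSpace ℝ EN]
    {HN : Type*} [TopologicalSpace HN] {IN : ModelWithCorners ℝ EN HN}
    {N : Type*} [TopologicalSpace N] [ChartedSpace HN N]
    (ψ : E →ₗ[ℝ] Cₛ^∞⟮IM; F, A⟯) {f : N → E} (hf : ContMDiff IN 𝓘(ℝ, E) ∞ f)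
    {a : N → TotalSpace F A} (ha : ContMDiff IN (IM.prod 𝓘(ℝ, F)) ∞ a) :
    ContMDiff IN (IM.prod 𝓘(ℝ, F)) ∞
      (fun p => (⟨(a p).proj, (a p).2 + ψ (f p) (a p).proj⟩ : TotalSpace F A)) := by
  intro p₀
  have hb : ContMDiff IN IM ∞ (fun p => (a p).proj) := (contMDiff_proj A).comp ha
  refine contMDiffAt_totalSpace.2 ⟨hb p₀, ?_⟩
  set e := trivializationAt F A (a p₀).proj with he
  -- The map ψ is only algebraically linear. A finite basis writes ψ(f p) as a finite sum of smooth
  -- coefficients times fixed smooth sections, which gives joint smoothness.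
  set b := Module.finBasis ℝ E
  have hsum : ContMDiffAt IN 𝓘(ℝ, F) ∞ (fun p => (e (a p)).2
      + ∑ i, b.repr (f p) i • (e ⟨(a p).proj, ψ (b i) (a p).proj⟩).2) p₀ := by
    refine ((contMDiffAt_totalSpace.1 (ha p₀)).2).add ?_
    refine contMDiffAt_finsetSum fun i _ => ?_
    have h1 : ContMDiffAt IN 𝓘(ℝ, ℝ) ∞ (fun p => b.repr (f p) i) p₀ :=
      (LinearMap.toContinuousLinearMap (b.coord i)).contMDiff.contMDiffAt.comp p₀ (hf p₀)
    have h2 : ContMDiffAt IN (IM.prod 𝓘(ℝ, F)) ∞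
        (fun p => (⟨(a p).proj, ψ (b i) (a p).proj⟩ : TotalSpace F A)) p₀ :=
      ((ψ (b i)).contMDiff.comp hb) p₀
    exact h1.smul (contMDiffAt_totalSpace.1 h2).2
  refine hsum.congr_of_eventuallyEq ?_
  have hmem : ∀ᶠ p in nhds p₀, (a p).proj ∈ e.baseSet :=
    (hb.continuous.continuousAt).preimage_mem_nhds
      (e.open_baseSet.mem_nhds (FiberBundle.mem_baseSet_trivializationAt' _))
  filter_upwards [hmem] with p hp
  have hlin : ∀ v : A (a p).proj, (e ⟨(a p).proj, v⟩).2 = e.linearMapAt ℝ (a p).proj v := fun v => by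
    rw [Trivialization.coe_linearMapAt_of_mem _ hp]
  have hexp : ψ (f p) (a p).proj = ∑ i, b.repr (f p) i • ψ (b i) (a p).proj := by
    have := congrArg (fun z => evalSection IM F A (a p).proj (ψ z)) (b.sum_repr (f p))
    simp only [map_sum, map_smul] at this
    exact this.symm
  simp only [hlin]
  rw [hexp, map_add, map_sum]
  simp only [map_smul]

end Sections

set_option linter.unusedSectionVars false

/-! ### Linear coordinates on a single fibre. -/

section FiberInclusion

variable {EM : Type*} [NormedAddCommGroup EM] [NormedSpace ℝ EM]
  {HM : Type*} [TopologicalSpace HM] {IM : ModelWithCorners ℝ EM HM}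
  {M : Type*} [TopologicalSpace M] [ChartedSpace HM M]
  {F : Type*} [NormedAddCommGroup F] [NormedSpace ℝ F]
  {A : M → Type*} [TopologicalSpace (TotalSpace F A)] [∀ x, TopologicalSpace (A x)]
  [∀ x, AddCommGroup (A x)] [∀ x, Module ℝ (A x)] [FiberBundle F A] [VectorBundle ℝ F A]

/-- The preferred linear coordinates on a fibre of a vector bundle. -/
def fiberCoord (F : Type*) [NormedAddCommGroup F] [NormedSpace ℝ F]
    (A : M → Type*) [TopologicalSpace (TotalSpace F A)] [∀ x, TopologicalSpace (A x)]
    [∀ x, AddCommGroup (A x)] [∀ x, Module ℝ (A x)] [FiberBundle F A] [VectorBundle ℝ F A]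
    (x : M) : A x ≃L[ℝ] F :=
  (trivializationAt F A x).continuousLinearEquivAt ℝ x (FiberBundle.mem_baseSet_trivializationAt' x)

theorem contMDiff_fiberCoord_symm (x : M) :
    ContMDiff 𝓘(ℝ, F) (IM.prod 𝓘(ℝ, F)) ∞
      (fun f : F => (⟨x, (fiberCoord F A x).symm f⟩ : TotalSpace F A)) := by
  intro f
  refine contMDiffAt_totalSpace.2 ⟨contMDiffAt_const, ?_⟩
  refine contMDiffAt_id.congr_of_eventuallyEq (Filter.Eventually.of_forall fun z => ?_)
  exact (fiberCoord F A x).apply_symm_apply z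

theorem mk_fiberCoord_symm_trivializationAt {x : M} {a : TotalSpace F A} (ha : a.proj = x) :
    (⟨x, (fiberCoord F A x).symm (trivializationAt F A x a).2⟩ : TotalSpace F A) = a := by
  obtain ⟨y, v⟩ := a
  obtain rfl : y = x := ha
  exact congrArg (TotalSpace.mk y) ((fiberCoord F A y).symm_apply_apply v)

/-- Smoothness into the total space is tested in the trivialization at the current base point; for a
map into one fibre this trivialization is always the same. -/
theorem contMDiff_trivializationAt_snd [ContMDiffVectorBundle ∞ F A IM]
    {EN : Type*} [NormedAddCommGroup EN] [NormedSpace ℝ EN]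
    {HN : Type*} [TopologicalSpace HN] {IN : ModelWithCorners ℝ EN HN}
    {N : Type*} [TopologicalSpace N] [ChartedSpace HN N]
    {a : N → TotalSpace F A} (ha : ContMDiff IN (IM.prod 𝓘(ℝ, F)) ∞ a) {x : M}
    (hx : ∀ p, (a p).proj = x) :
    ContMDiff IN 𝓘(ℝ, F) ∞ (fun p => (trivializationAt F A x (a p)).2) := by
  intro p
  have := (contMDiffAt_totalSpace.1 (ha p)).2
  rwa [hx p] at this

end FiberInclusion

/-! ### A chain rule along graphs. -/

section Graph

variable {EK : Type*} [NormedAddCommGroup EK] [NormedSpace ℝ EK]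
  {HK : Type*} [TopologicalSpace HK] {IK : ModelWithCorners ℝ EK HK}
  {K : Type*} [TopologicalSpace K] [ChartedSpace HK K]
  {E : Type*} [NormedAddCommGroup E] [NormedSpace ℝ E]

/-- The chain rule for `k ↦ h (k, u k)` when `h (k₀, ·)` is linear. -/
theorem mfderiv_comp_graph {h : K × E → ℝ} {u : K → E} {k : K}
    (hh : MDifferentiableAt (IK.prod 𝓘(ℝ, E)) 𝓘(ℝ, ℝ) h (k, u k))
    (hu : MDifferentiableAt IK 𝓘(ℝ, E) u k) (l : E →L[ℝ] ℝ) (hl : ∀ z, h (k, z) = l z) (v : EK) :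
    @Eq ℝ (mfderiv IK 𝓘(ℝ, ℝ) (fun k => h (k, u k)) k v)
      (@HAdd.hAdd ℝ ℝ ℝ _ (mfderiv IK 𝓘(ℝ, ℝ) (fun k' => h (k', u k)) k v)
        (l (mfderiv IK 𝓘(ℝ, E) u k v))) := by
  have h1 := mfderiv_comp_apply (I := IK) (I' := IK.prod 𝓘(ℝ, E)) (I'' := 𝓘(ℝ, ℝ)) k
    (f := fun k => (k, u k)) hh (mdifferentiableAt_id.prodMk hu) v
  have h2 : mfderiv IK (IK.prod 𝓘(ℝ, E)) (fun k => (k, u k)) k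
      = (mfderiv IK IK (fun k : K => k) k).prod (mfderiv IK 𝓘(ℝ, E) u k) :=
    mfderiv_prodMk mdifferentiableAt_id hu
  refine h1.trans ?_
  rw [h2]
  refine (mfderiv_prod_eq_add_apply hh).trans ?_
  have h3 : (fun z => h (k, z)) = l := funext hl
  refine congrArg₂ (fun a b : ℝ => a + b) ?_ ?_
  · have : mfderiv IK IK (fun k : K => k) k = ContinuousLinearMap.id ℝ _ := mfderiv_id
    rw [this]; rfl
  · have : (mfderiv 𝓘(ℝ, E) 𝓘(ℝ, ℝ) (fun z => h (k, z)) (u k) : E →L[ℝ] ℝ) = l := by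
      rw [h3, mfderiv_eq_fderiv, l.fderiv]
    exact congrArg (fun L : E →L[ℝ] ℝ => L (mfderiv IK 𝓘(ℝ, E) u k v : E)) this

end Graph

/-! ### Actions by complete lifts and the equivariance of ψ. -/

section Equivariance

variable {EM : Type*} [NormedAddCommGroup EM] [NormedSpace ℝ EM]
  {HM : Type*} [TopologicalSpace HM] {IM : ModelWithCorners ℝ EM HM}
  {M : Type*} [TopologicalSpace M] [ChartedSpace HM M]
  {F : Type*} [NormedAddCommGroup F] [NormedSpace ℝ F]
  {A : M → Type*} [TopologicalSpace (TotalSpace F A)] [∀ x, TopologicalSpace (A x)]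
  [∀ x, AddCommGroup (A x)] [∀ x, Module ℝ (A x)] [FiberBundle F A] [VectorBundle ℝ F A]

/-- The map induced on the base by a map of the total space. -/
def baseAction {K : Type*} (Φ : K → TotalSpace F A → TotalSpace F A) (k : K) (x : M) : M :=
  (Φ k ⟨x, 0⟩).proj

variable {EK : Type*} [NormedAddCommGroup EK] [NormedSpace ℝ EK]
  {HK : Type*} [TopologicalSpace HK] {IK : ModelWithCorners ℝ EK HK}
  {K : Type*} [TopologicalSpace K] [ChartedSpace HK K] [Group K]
  {Φ : K → TotalSpace F A → TotalSpace F A}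

namespace IsLinearAction

theorem exists_linearMap (hΦ : IsLinearAction IM IK Φ) (k : K) (x : M) :
    ∃ T : A x →ₗ[ℝ] A (baseAction Φ k x), ∀ v, Φ k ⟨x, v⟩ = ⟨baseAction Φ k x, T v⟩ := by
  obtain ⟨y, T, hT⟩ := hΦ.fiberwise k x
  obtain rfl : baseAction Φ k x = y := congrArg TotalSpace.proj (hT 0)
  exact ⟨T, hT⟩

theorem proj_apply (hΦ : IsLinearAction IM IK Φ) (k : K) (a : TotalSpace F A) :
    (Φ k a).proj = baseAction Φ k a.proj := by
  obtain ⟨T, hT⟩ := hΦ.exists_linearMap k a.proj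
  exact (congrArg TotalSpace.proj (hT a.2) :)

theorem baseAction_one (hΦ : IsLinearAction IM IK Φ) (x : M) : baseAction Φ 1 x = x := by
  rw [baseAction, hΦ.one_act]

theorem baseAction_mul (hΦ : IsLinearAction IM IK Φ) (k l : K) (x : M) :
    baseAction Φ (k * l) x = baseAction Φ k (baseAction Φ l x) := by
  rw [baseAction, hΦ.mul_act, hΦ.proj_apply]; rfl

theorem act_inv (hΦ : IsLinearAction IM IK Φ) (k : K) (a : TotalSpace F A) :
    Φ k (Φ k⁻¹ a) = a := by
  rw [← hΦ.mul_act, mul_inv_cancel, hΦ.one_act]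

theorem baseAction_inv (hΦ : IsLinearAction IM IK Φ) (k : K) (x : M) :
    baseAction Φ k⁻¹ (baseAction Φ k x) = x := by
  rw [← hΦ.baseAction_mul, inv_mul_cancel, hΦ.baseAction_one]

theorem contMDiff_orbit (hΦ : IsLinearAction IM IK Φ) (a : TotalSpace F A) :
    ContMDiff IK (IM.prod 𝓘(ℝ, F)) ∞ (fun k => Φ k a) :=
  hΦ.smooth.comp (contMDiff_id.prodMk contMDiff_const)

theorem contMDiff_baseAction [ContMDiffVectorBundle ∞ F A IM] (hΦ : IsLinearAction IM IK Φ)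
    (x : M) : ContMDiff IK IM ∞ (fun k => baseAction Φ k x) :=
  (contMDiff_proj A).comp (hΦ.contMDiff_orbit _)

theorem contMDiff_baseAction_mk_zero [ContMDiffVectorBundle ∞ F A IM]
    (hΦ : IsLinearAction IM IK Φ) (x : M) :
    ContMDiff IK (IM.prod 𝓘(ℝ, F)) ∞
      (fun k => (⟨baseAction Φ k x, 0⟩ : TotalSpace F A)) :=
  (contMDiff_zeroSection ℝ A).comp (hΦ.contMDiff_baseAction x)

end IsLinearAction

variable [IsManifold IM ∞ M] [ContMDiffVectorBundle ∞ F A IM]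
  {EG : Type*} [NormedAddCommGroup EG] [NormedSpace ℝ EG]
  {HG : Type*} [TopologicalSpace HG] {IG : ModelWithCorners ℝ EG HG}
  {G : Type*} [TopologicalSpace G] [ChartedSpace HG G] [Group G]
  {L : LieAlgebroid IM F A} {Φ : G → TotalSpace F A → TotalSpace F A}
  {ψ : GroupLieAlgebra IG G →ₗ[ℝ] Cₛ^∞⟮IM; F, A⟯}

/-- The curve `g ↦ ψ(Ad_g ξ)(φ_g x)` in the total space. -/
def adjointSectionOrbit (Φ : G → TotalSpace F A → TotalSpace F A)
    (ψ : GroupLieAlgebra IG G →ₗ[ℝ] Cₛ^∞⟮IM; F, A⟯) (ξ : GroupLieAlgebra IG G) (x : M) (g : G) :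
    TotalSpace F A :=
  ⟨baseAction Φ g x, ψ (lieAd IG g ξ) (baseAction Φ g x)⟩

/-- The curve `g ↦ Φ_{g⁻¹}(ψ(Ad_g ξ)(φ_g x))`, read in the coordinates of the fibre over `x`. -/
def equivarianceDefect (Φ : G → TotalSpace F A → TotalSpace F A)
    (ψ : GroupLieAlgebra IG G →ₗ[ℝ] Cₛ^∞⟮IM; F, A⟯) (ξ : GroupLieAlgebra IG G) (x : M) (g : G) :
    F :=
  (trivializationAt F A x (Φ g⁻¹ (adjointSectionOrbit Φ ψ ξ x g))).2

omit [IsManifold IM ∞ M] in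
/-- The vertical lift of a value of a linear family of sections, as a derivative in the
parameter. -/
theorem verticalLift_apply_linear {E : Type*} [NormedAddCommGroup E] [NormedSpace ℝ E]
    [FiniteDimensional ℝ E] (ψ : E →ₗ[ℝ] Cₛ^∞⟮IM; F, A⟯) (η : E) (a : TotalSpace F A) :
    @Eq (EM × F) (verticalLift (ψ η) a) (mfderiv 𝓘(ℝ, E) (IM.prod 𝓘(ℝ, F))
      (fun ζ => (⟨a.proj, a.2 + ψ ζ a.proj⟩ : TotalSpace F A)) 0 η) := by
  set j : E → TotalSpace F A := fun ζ => ⟨a.proj, a.2 + ψ ζ a.proj⟩ with hj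
  have hjs : ContMDiff 𝓘(ℝ, E) (IM.prod 𝓘(ℝ, F)) ∞ j :=
    contMDiff_add_linear_section ψ contMDiff_id (contMDiff_const (c := a))
  have h2 : (fun t : ℝ => (⟨a.proj, a.2 + t • ψ η a.proj⟩ : TotalSpace F A))
      = j ∘ fun t : ℝ => t • η := by
    funext t
    exact congrArg (fun Y : Cₛ^∞⟮IM; F, A⟯ => (⟨a.proj, a.2 + Y a.proj⟩ : TotalSpace F A))
      (map_smul ψ t η).symm
  have hd : HasFDerivAt (fun t : ℝ => t • η) ((ContinuousLinearMap.id ℝ ℝ).smulRight η) 0 :=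
    (hasFDerivAt_id (0 : ℝ)).smul_const η
  have h3 := mfderiv_comp_apply_of_eq (I := 𝓘(ℝ, ℝ)) (I' := 𝓘(ℝ, E))
    (I'' := IM.prod 𝓘(ℝ, F)) (0 : ℝ) (y := (0 : E)) (hjs.mdifferentiable (by simp) 0)
    hd.differentiableAt.mdifferentiableAt (zero_smul ℝ η) (1 : ℝ)
  have h4 : @Eq E (mfderiv 𝓘(ℝ, ℝ) 𝓘(ℝ, E) (fun t : ℝ => t • η) 0 (1 : ℝ)) η := by
    refine (congrArg (fun T : ℝ →L[ℝ] E => T 1) (mfderiv_eq_fderiv.trans hd.fderiv)).trans ?_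
    exact one_smul ℝ η
  refine (congrArg (fun q : ℝ → TotalSpace F A =>
    (mfderiv 𝓘(ℝ, ℝ) (IM.prod 𝓘(ℝ, F)) q 0 (1 : ℝ) : EM × F)) h2).trans (h3.trans ?_)
  exact congrArg (mfderiv 𝓘(ℝ, E) (IM.prod 𝓘(ℝ, F)) j 0 : E →L[ℝ] EM × F) h4

namespace IsActionByCompleteLifts

/-- φ_{g⁻¹} undoes φ_g on the base. Since the curve stays in one fibre, its coordinate form
`equivarianceDefect` loses no information and can be differentiated in `F`. -/
theorem proj_inv_adjointSectionOrbit (hΦ : IsActionByCompleteLifts L Φ ψ)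
    (ξ : GroupLieAlgebra IG G) (x : M) (g : G) :
    (Φ g⁻¹ (adjointSectionOrbit Φ ψ ξ x g)).proj = x := by
  rw [hΦ.toIsLinearAction.proj_apply]
  exact hΦ.toIsLinearAction.baseAction_inv g x

theorem mk_equivarianceDefect (hΦ : IsActionByCompleteLifts L Φ ψ)
    (ξ : GroupLieAlgebra IG G) (x : M) (g : G) :
    (⟨x, (fiberCoord F A x).symm (equivarianceDefect Φ ψ ξ x g)⟩ : TotalSpace F A)
      = Φ g⁻¹ (adjointSectionOrbit Φ ψ ξ x g) :=
  mk_fiberCoord_symm_trivializationAt (hΦ.proj_inv_adjointSectionOrbit ξ x g)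

variable [LieGroup IG ∞ G]

theorem adjointSectionOrbit_one (hΦ : IsActionByCompleteLifts L Φ ψ)
    (ξ : GroupLieAlgebra IG G) (x : M) : adjointSectionOrbit Φ ψ ξ x 1 = ⟨x, ψ ξ x⟩ := by
  rw [adjointSectionOrbit, hΦ.toIsLinearAction.baseAction_one, lieAd_one]

/-- A consequence of Ad and φ both being actions; it reduces derivatives at an arbitrary group
element to derivatives at 1. -/
theorem adjointSectionOrbit_mul (hΦ : IsActionByCompleteLifts L Φ ψ)
    (ξ : GroupLieAlgebra IG G) (x : M) (g h : G) :
    adjointSectionOrbit Φ ψ ξ x (g * h)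
      = adjointSectionOrbit Φ ψ (lieAd IG h ξ) (baseAction Φ h x) g := by
  rw [adjointSectionOrbit, hΦ.toIsLinearAction.baseAction_mul, lieAd_mul]; rfl

variable [FiniteDimensional ℝ EG]

theorem contMDiff_adjointSectionOrbit (hΦ : IsActionByCompleteLifts L Φ ψ)
    (ξ : GroupLieAlgebra IG G) (x : M) :
    ContMDiff IG (IM.prod 𝓘(ℝ, F)) ∞ (adjointSectionOrbit Φ ψ ξ x) := by
  refine (contMDiff_add_linear_section (E := EG) ψ (contMDiff_adjointOrbit (IG := IG) ξ)
    (hΦ.toIsLinearAction.contMDiff_baseAction_mk_zero x)).congr fun g => ?_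
  exact congrArg (TotalSpace.mk (baseAction Φ g x)) (zero_add _).symm

theorem contMDiff_equivarianceDefect (hΦ : IsActionByCompleteLifts L Φ ψ)
    (ξ : GroupLieAlgebra IG G) (x : M) :
    ContMDiff IG 𝓘(ℝ, F) ∞ (equivarianceDefect Φ ψ ξ x) :=
  contMDiff_trivializationAt_snd (hΦ.smooth.comp
    ((contMDiff_inv IG ∞).prodMk (hΦ.contMDiff_adjointSectionOrbit ξ x)))
    (hΦ.proj_inv_adjointSectionOrbit ξ x)

omit [FiniteDimensional ℝ EG] in
/-- The derivative of `g ↦ α̂(Φ_g a)` at the identity. -/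
theorem mfderiv_linearFunction_orbit (hΦ : IsActionByCompleteLifts L Φ ψ) (α : DualSection IM F A)
    (η : GroupLieAlgebra IG G) (Y : Cₛ^∞⟮IM; F, A⟯) (x : M) :
    @Eq ℝ (mfderiv IG 𝓘(ℝ, ℝ) (fun g => α.linearFunction (Φ g ⟨x, Y x⟩)) 1 η)
      (L.lieDerivative (ψ η) α Y x) := by
  refine Eq.trans ?_ ((hΦ.generator η).linear α Y x)
  exact mfderiv_comp_apply_of_eq (I := IG) (I' := IM.prod 𝓘(ℝ, F)) (I'' := 𝓘(ℝ, ℝ)) _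
    (α.contMDiff_linearFunction.mdifferentiable (by simp) _)
    ((hΦ.toIsLinearAction.contMDiff_orbit _).mdifferentiable (by simp) 1) (hΦ.one_act _) η

omit [FiniteDimensional ℝ EG] in
/-- The derivative of `g ↦ f(φ_g x)` at the identity. -/
theorem mfderiv_comp_baseAction (hΦ : IsActionByCompleteLifts L Φ ψ) {f : M → ℝ} {x : M}
    (hf : MDifferentiableAt IM 𝓘(ℝ, ℝ) f x) (η : GroupLieAlgebra IG G) :
    @Eq ℝ (mfderiv IG 𝓘(ℝ, ℝ) (fun g => f (baseAction Φ g x)) 1 η) (L.dFunction f (ψ η) x) := by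
  have h1 := mfderiv_comp_apply_of_eq (I := IG) (I' := IM) (I'' := 𝓘(ℝ, ℝ)) _ hf
    ((hΦ.toIsLinearAction.contMDiff_baseAction x).mdifferentiable (by simp) 1)
    (hΦ.toIsLinearAction.baseAction_one x) η
  have h2 := mfderiv_comp_apply_of_eq (I := IG) (I' := IM.prod 𝓘(ℝ, F)) (I'' := IM) _
    (y := (⟨x, 0⟩ : TotalSpace F A)) (g := fun b : TotalSpace F A => b.proj)
    ((contMDiff_proj (n := ∞) A).mdifferentiable (by simp) _)
    ((hΦ.toIsLinearAction.contMDiff_orbit ⟨x, 0⟩).mdifferentiable (by simp) 1)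
    (hΦ.one_act _) η
  refine h1.trans (congrArg (mfderiv IM 𝓘(ℝ, ℝ) f x) ?_)
  exact h2.trans ((hΦ.generator η).projectable ⟨x, 0⟩)

variable [FiniteDimensional ℝ EM] [T2Space M] [IG.Boundaryless]

/-- The infinitesimal heart of the proof: the complete lift condition, the antimorphism property and
the derivative of Ad cancel exactly. -/
theorem mfderiv_equivarianceDefect_one (hΦ : IsActionByCompleteLifts L Φ ψ)
    (ξ : GroupLieAlgebra IG G) (x : M) (η : EG) :
    @Eq F (mfderiv IG 𝓘(ℝ, F) (equivarianceDefect Φ ψ ξ x) 1 η) 0 := by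
  set u := equivarianceDefect Φ ψ ξ x with hu
  have hus := hΦ.contMDiff_equivarianceDefect ξ x
  refine (fiberCoord F A x).symm.injective ?_
  rw [map_zero]
  refine eq_zero_of_forall_dualSection (IM := IM) (F := F) fun α => ?_
  set h : G × F → ℝ := fun p => α.linearFunction (Φ p.1 ⟨x, (fiberCoord F A x).symm p.2⟩) with hh
  have hhs : ContMDiff (IG.prod 𝓘(ℝ, F)) 𝓘(ℝ, ℝ) ∞ h :=
    α.contMDiff_linearFunction.comp (hΦ.smooth.comp
      (contMDiff_fst.prodMk ((contMDiff_fiberCoord_symm x).comp contMDiff_snd)))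
  set k : G × EG → ℝ := fun p => α.pairing (ψ p.2) (baseAction Φ p.1 x) with hk
  have hks : ContMDiff (IG.prod 𝓘(ℝ, EG)) 𝓘(ℝ, ℝ) ∞ k := by
    refine (α.contMDiff_linearFunction.comp (contMDiff_add_linear_section (E := EG) ψ
      contMDiff_snd ((hΦ.toIsLinearAction.contMDiff_baseAction_mk_zero x).comp
        contMDiff_fst))).congr fun p => ?_
    exact congrArg (α (baseAction Φ p.1 x)) (zero_add _).symm
  have hpair : ∀ Y : Cₛ^∞⟮IM; F, A⟯, MDifferentiableAt IM 𝓘(ℝ, ℝ) (α.pairing Y) x := fun Y =>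
    (α.contMDiff_linearFunction.comp Y.contMDiff).mdifferentiable (by simp) x
  -- The same function of g is written along two graphs. Each of `h` and `k` is linear in its second
  -- variable at g = 1, so `mfderiv_comp_graph` computes its derivative in two ways.
  have hhk : (fun g => h (g, u g)) = fun g => k (g, adjointOrbit (IG := IG) ξ g) := by
    funext g
    change α.linearFunction (Φ g ⟨x, (fiberCoord F A x).symm (u g)⟩) = _
    rw [hu, hΦ.mk_equivarianceDefect, hΦ.toIsLinearAction.act_inv]
    rfl
  have hu1 : (⟨x, (fiberCoord F A x).symm (u 1)⟩ : TotalSpace F A) = ⟨x, ψ ξ x⟩ := by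
    rw [hu, hΦ.mk_equivarianceDefect, inv_one, hΦ.one_act, hΦ.adjointSectionOrbit_one]
  have ha1 : adjointOrbit (IG := IG) ξ (1 : G) = ξ := lieAd_one ξ
  have d1 := mfderiv_comp_graph (IK := IG) (k := (1 : G)) (hhs.mdifferentiable (by simp) _)
    (hus.mdifferentiable (by simp) 1) ((α x) ∘L ((fiberCoord F A x).symm : F →L[ℝ] A x))
    (fun z => by simp only [hh, hΦ.one_act]; rfl) η
  have d2 := mfderiv_comp_graph (IK := IG) (k := (1 : G)) (hks.mdifferentiable (by simp) _)
    ((contMDiff_adjointOrbit (IG := IG) ξ).mdifferentiable (by simp) 1)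
    (LinearMap.toContinuousLinearMap
      (((α x : A x →L[ℝ] ℝ) : A x →ₗ[ℝ] ℝ) ∘ₗ evalSection IM F A x ∘ₗ (ψ : EG →ₗ[ℝ] _)))
    (fun z => by simp only [hk, hΦ.toIsLinearAction.baseAction_one]; rfl) η
  have t1 := hΦ.mfderiv_linearFunction_orbit α η (ψ ξ) x
  have t2 := hΦ.mfderiv_comp_baseAction (hpair (ψ ξ)) η
  have d1' : @Eq ℝ (mfderiv IG 𝓘(ℝ, ℝ) (fun g => h (g, u g)) 1 η)
      (L.lieDerivative (ψ η) α (ψ ξ) x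
        + α x ((fiberCoord F A x).symm (mfderiv IG 𝓘(ℝ, F) u 1 η : F))) := by
    refine d1.trans (congrArg (fun r : ℝ =>
      r + α x ((fiberCoord F A x).symm (mfderiv IG 𝓘(ℝ, F) u 1 η : F))) ?_)
    refine Eq.trans ?_ t1
    exact congrArg (fun a : TotalSpace F A =>
      (mfderiv IG 𝓘(ℝ, ℝ) (fun g => α.linearFunction (Φ g a)) 1 η : ℝ)) hu1
  have d2' : @Eq ℝ (mfderiv IG 𝓘(ℝ, ℝ) (fun g => h (g, u g)) 1 η)
      (L.dFunction (α.pairing (ψ ξ)) (ψ η) x + α x (ψ (Bracket.bracket (L := GroupLieAlgebra IG G) (M := GroupLieAlgebra IG G) η ξ) x)) := by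
    rw [hhk]
    refine d2.trans (congrArg₂ (fun r s : ℝ => r + s) ?_ ?_)
    · refine Eq.trans ?_ t2
      exact congrArg (fun z : EG => (mfderiv IG 𝓘(ℝ, ℝ) (fun g => k (g, z)) 1 η : ℝ)) ha1
    · exact congrArg (fun z : EG => α x (ψ z x)) (mfderiv_adjointOrbit η ξ)
  have hb : α x (ψ (Bracket.bracket (L := GroupLieAlgebra IG G) (M := GroupLieAlgebra IG G) η ξ) x)
      = -α.pairing (L.bracket (ψ η) (ψ ξ)) x :=
    (congrArg (fun Y : Cₛ^∞⟮IM; F, A⟯ => α x (Y x)) (hΦ.antimorphism η ξ)).trans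
      ((α x).map_neg _)
  -- The bracket term in ℒ_{ψ(η)} α equals α(ψ([η, ξ])) by `hb`, and the two anchor derivatives of
  -- α(ψ(η)) inside ℒ cancel; what remains is α(u'(η)) = 0.
  have key := d1'.symm.trans d2'
  rw [hb] at key
  simp only [LieAlgebroid.lieDerivative, LieAlgebroid.dForm] at key
  change @Eq ℝ (α x ((fiberCoord F A x).symm (mfderiv IG 𝓘(ℝ, F) u 1 η : F))) 0
  linear_combination key

/-- Writing g = (g h⁻¹) h presents the curve for (ξ, x) as the curve for (Ad_h ξ, φ_h x) at g h⁻¹,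
followed by Φ_{h⁻¹} from the fibre over φ_h x to that over x. At g = h the inner curve is at 1,
where its derivative is zero. -/
theorem mfderiv_equivarianceDefect (hΦ : IsActionByCompleteLifts L Φ ψ)
    (ξ : GroupLieAlgebra IG G) (x : M) (h : G) :
    mfderiv IG 𝓘(ℝ, F) (equivarianceDefect Φ ψ ξ x) h = 0 := by
  set x' := baseAction Φ h x with hx'
  set S : F → F := fun f =>
    (trivializationAt F A x (Φ h⁻¹ ⟨x', (fiberCoord F A x').symm f⟩)).2 with hS
  have hSs : ContMDiff 𝓘(ℝ, F) 𝓘(ℝ, F) ∞ S := by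
    refine contMDiff_trivializationAt_snd (IM := IM) (hΦ.smooth.comp
      (contMDiff_const.prodMk (contMDiff_fiberCoord_symm x'))) fun f => ?_
    refine (hΦ.toIsLinearAction.proj_apply _ _).trans ?_
    exact hΦ.toIsLinearAction.baseAction_inv h x
  have hu := hΦ.contMDiff_equivarianceDefect (lieAd IG h ξ) x'
  have hcomp : equivarianceDefect Φ ψ ξ x
      = (S ∘ equivarianceDefect Φ ψ (lieAd IG h ξ) x') ∘ fun g => g * h⁻¹ := by
    funext g
    simp only [Function.comp_apply, hS]
    rw [hΦ.mk_equivarianceDefect, ← hΦ.adjointSectionOrbit_mul, ← hΦ.mul_act,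
      inv_mul_cancel_right, ← mul_inv_rev, inv_mul_cancel_right]
    rfl
  rw [hcomp]
  have h1 : MDifferentiableAt 𝓘(ℝ, F) 𝓘(ℝ, F) S
      (equivarianceDefect Φ ψ (lieAd IG h ξ) x' 1) := hSs.mdifferentiable (by simp) _
  have h2 : MDifferentiableAt IG 𝓘(ℝ, F) (equivarianceDefect Φ ψ (lieAd IG h ξ) x') 1 :=
    hu.mdifferentiable (by simp) 1
  ext η
  refine (mfderiv_comp_apply_of_eq (I := IG) (I' := IG) (I'' := 𝓘(ℝ, F)) _ (h1.comp 1 h2)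
    ((contMDiff_mul_right (I := IG) (n := ∞) (a := h⁻¹)).mdifferentiable (by simp) h)
    (mul_inv_cancel h) η).trans ?_
  refine (mfderiv_comp_apply (I := IG) (I' := 𝓘(ℝ, F)) (I'' := 𝓘(ℝ, F)) 1 h1 h2 _).trans ?_
  refine (congrArg (fun z : F => (mfderiv 𝓘(ℝ, F) 𝓘(ℝ, F) S
      (equivarianceDefect Φ ψ (lieAd IG h ξ) x' 1) : F →L[ℝ] F) z)
    (hΦ.mfderiv_equivarianceDefect_one (lieAd IG h ξ) x' _)).trans ?_
  exact map_zero (mfderiv 𝓘(ℝ, F) 𝓘(ℝ, F) S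
      (equivarianceDefect Φ ψ (lieAd IG h ξ) x' 1) : F →L[ℝ] F)

/-- The map `ψ` is equivariant: `Φ_g(ψ(ξ)(x)) = ψ(Ad_g ξ)(φ_g x)`. -/
theorem apply_section [ConnectedSpace G] (hΦ : IsActionByCompleteLifts L Φ ψ)
    (g : G) (ξ : GroupLieAlgebra IG G) (x : M) :
    Φ g ⟨x, ψ ξ x⟩ = ⟨baseAction Φ g x, ψ (lieAd IG g ξ) (baseAction Φ g x)⟩ := by
  have : IsManifold IG 1 G := IsManifold.of_le (n := ∞) (by simp)
  -- Connectedness enters here: the curve equals its value at 1, which is ψ(ξ)(x).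
  have hconst := eq_of_mfderiv_eq_zero
    ((hΦ.contMDiff_equivarianceDefect ξ x).mdifferentiable (by simp))
    (hΦ.mfderiv_equivarianceDefect ξ x) g 1
  have h1 := hΦ.mk_equivarianceDefect ξ x g
  rw [hconst, hΦ.mk_equivarianceDefect, inv_one, hΦ.one_act, hΦ.adjointSectionOrbit_one] at h1
  rw [h1, hΦ.toIsLinearAction.act_inv]
  rfl

/-! ### The induced affine action and its generators. -/

theorem inducedAction_one (hΦ : IsActionByCompleteLifts L Φ ψ) (a : TotalSpace F A) :
    inducedAction Φ ψ 1 a = a := by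
  change Φ 1 ⟨a.proj, a.2 + ψ 0 a.proj⟩ = a
  rw [hΦ.one_act, map_zero]
  exact congrArg (TotalSpace.mk a.proj) (add_zero a.2)

/-- By equivariance, Φ_h carries the translation by ψ(Ad_{h⁻¹} ξ) to the translation by ψ(ξ), so the
twist in the product of G × 𝔤 is precisely what moving ψ(ξ) past Φ_h requires. -/
theorem inducedAction_mul [ConnectedSpace G] (hΦ : IsActionByCompleteLifts L Φ ψ)
    (k l : TangentGroup IG G) (a : TotalSpace F A) :
    inducedAction Φ ψ (k * l) a = inducedAction Φ ψ k (inducedAction Φ ψ l a) := by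
  obtain ⟨x, v⟩ := a
  obtain ⟨T, hT⟩ := hΦ.toIsLinearAction.exists_linearMap l.base x
  have he := hΦ.apply_section l.base (lieAd IG l.base⁻¹ k.vec) x
  rw [hT, ← lieAd_mul, mul_inv_cancel, lieAd_one] at he
  have he' : T (ψ (lieAd IG l.base⁻¹ k.vec) x) = ψ k.vec (baseAction Φ l.base x) :=
    TotalSpace.mk_injective _ he
  change Φ (k.base * l.base) ⟨x, v + ψ (l.vec + lieAd IG l.base⁻¹ k.vec) x⟩
    = inducedAction Φ ψ k (Φ l.base ⟨x, v + ψ l.vec x⟩)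
  rw [hΦ.mul_act, hT, hT]
  change _ = Φ k.base ⟨_, T (v + ψ l.vec x) + ψ k.vec (baseAction Φ l.base x)⟩
  rw [← he', ← map_add, map_add ψ, add_assoc]
  rfl

omit [FiniteDimensional ℝ EM] [T2Space M] [IG.Boundaryless] in
theorem contMDiff_inducedAction (hΦ : IsActionByCompleteLifts L Φ ψ) :
    ContMDiff ((IG.prod 𝓘(ℝ, EG)).prod (IM.prod 𝓘(ℝ, F))) (IM.prod 𝓘(ℝ, F)) ∞
      (fun p : TangentGroup IG G × TotalSpace F A => inducedAction Φ ψ p.1 p.2) := by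
  have h1 : ContMDiff ((IG.prod 𝓘(ℝ, EG)).prod (IM.prod 𝓘(ℝ, F))) IG ∞
      (fun p : (G × EG) × TotalSpace F A => p.1.1) := contMDiff_fst.comp contMDiff_fst
  have h2 : ContMDiff ((IG.prod 𝓘(ℝ, EG)).prod (IM.prod 𝓘(ℝ, F))) 𝓘(ℝ, EG) ∞
      (fun p : (G × EG) × TotalSpace F A => p.1.2) := contMDiff_snd.comp contMDiff_fst
  exact hΦ.smooth.comp (h1.prodMk (contMDiff_add_linear_section (E := EG) ψ h2 contMDiff_snd))

theorem isAffineAction_inducedAction [ConnectedSpace G] (hΦ : IsActionByCompleteLifts L Φ ψ) :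
    IsAffineAction IM (IG.prod 𝓘(ℝ, EG)) (inducedAction Φ ψ) where
  one_act := hΦ.inducedAction_one
  mul_act := hΦ.inducedAction_mul
  smooth := hΦ.contMDiff_inducedAction
  fiberwise k x := by
    obtain ⟨T, hT⟩ := hΦ.toIsLinearAction.exists_linearMap k.base x
    -- T is the linear map given by Φ on the fibre; translating before applying it adds the constant
    -- T(ψ(ξ)(x)).
    refine ⟨baseAction Φ k.base x, T.toAffineMap + AffineMap.const ℝ _ (T (ψ k.vec x)),
      fun v => ?_⟩
    change Φ k.base ⟨x, v + ψ k.vec x⟩ = ⟨_, T v + T (ψ k.vec x)⟩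
    rw [hT, map_add]

-- The derivative at (1, 0) is the sum of the partial derivatives: with zero Lie algebra component
-- the orbit map is that of Φ, and with group component 1 it is translation by ψ in the fibre.
omit [FiniteDimensional ℝ EM] [T2Space M] [IG.Boundaryless] in
theorem infinitesimalGenerator_inducedAction (hΦ : IsActionByCompleteLifts L Φ ψ)
    (ξ η : GroupLieAlgebra IG G) (a : TotalSpace F A) :
    infinitesimalGenerator (IG.prod 𝓘(ℝ, EG)) (IM.prod 𝓘(ℝ, F)) (inducedAction Φ ψ)
        (TangentGroup.lieMk ξ η) a
      = infinitesimalGenerator IG (IM.prod 𝓘(ℝ, F)) Φ ξ a + verticalLift (ψ η) a := by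
  set f : G × EG → TotalSpace F A := fun p => Φ p.1 ⟨a.proj, a.2 + ψ p.2 a.proj⟩ with hf
  have hfs : ContMDiff (IG.prod 𝓘(ℝ, EG)) (IM.prod 𝓘(ℝ, F)) ∞ f :=
    hΦ.smooth.comp (contMDiff_fst.prodMk
      (contMDiff_add_linear_section (E := EG) ψ contMDiff_snd (contMDiff_const (c := a))))
  have ha : (⟨a.proj, a.2 + ψ 0 a.proj⟩ : TotalSpace F A) = a := by
    rw [map_zero]
    exact congrArg (TotalSpace.mk a.proj) (add_zero a.2)
  have hmain := mfderiv_prod_eq_add_apply (I := IG) (I' := 𝓘(ℝ, EG)) (p := ((1 : G), (0 : EG)))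
    (v := ((ξ, η) : EG × EG)) (hfs.mdifferentiable (by simp) (1, 0))
  refine Eq.trans (b := (_ : EM × F)) hmain ?_
  refine congrArg₂ (fun v w : EM × F => v + w) ?_ ?_
  · exact congrArg (fun b : TotalSpace F A =>
      (mfderiv IG (IM.prod 𝓘(ℝ, F)) (fun g => Φ g b) 1 ξ : EM × F)) ha
  · have h1 : (fun z : EG => f (1, z)) = fun z => (⟨a.proj, a.2 + ψ z a.proj⟩ : TotalSpace F A) := by
      funext z
      exact hΦ.one_act _
    exact (congrArg (fun q : EG → TotalSpace F A =>
      (mfderiv 𝓘(ℝ, EG) (IM.prod 𝓘(ℝ, F)) q 0 η : EM × F)) h1).trans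
      (verticalLift_apply_linear (E := EG) ψ η a).symm

end IsActionByCompleteLifts

end Equivariance

end

theorem mainTheorem7
    {EM : Type*} [NormedAddCommGroup EM] [NormedSpace ℝ EM] [FiniteDimensional ℝ EM]
    {HM : Type*} [TopologicalSpace HM] (IM : ModelWithCorners ℝ EM HM) [IM.Boundaryless]
    {M : Type*} [TopologicalSpace M] [ChartedSpace HM M] [IsManifold IM ∞ M] [T2Space M]
    {F : Type*} [NormedAddCommGroup F] [NormedSpace ℝ F] [FiniteDimensional ℝ F]
    {A : M → Type*} [TopologicalSpace (TotalSpace F A)] [∀ x, TopologicalSpace (A x)]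
    [∀ x, AddCommGroup (A x)] [∀ x, Module ℝ (A x)] [FiberBundle F A] [VectorBundle ℝ F A]
    [ContMDiffVectorBundle ∞ F A IM]
    {EG : Type*} [NormedAddCommGroup EG] [NormedSpace ℝ EG] [FiniteDimensional ℝ EG]
    {HG : Type*} [TopologicalSpace HG] (IG : ModelWithCorners ℝ EG HG) [IG.Boundaryless]
    {G : Type*} [TopologicalSpace G] [ChartedSpace HG G] [Group G] [LieGroup IG ∞ G]
    [ConnectedSpace G]
    (L : LieAlgebroid IM F A)
    (Φ : G → TotalSpace F A → TotalSpace F A)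
    (ψ : GroupLieAlgebra IG G →ₗ[ℝ] Cₛ^∞⟮IM; F, A⟯)
    (hΦ : IsActionByCompleteLifts L Φ ψ) :
    IsAffineAction IM (IG.prod 𝓘(ℝ, EG)) (inducedAction Φ ψ) ∧
    ∀ ξ η : GroupLieAlgebra IG G,
      ∃ V : ∀ a : TotalSpace F A, TangentSpace (IM.prod 𝓘(ℝ, F)) a,
        L.IsCompleteLift (ψ ξ) V ∧
        ∀ a : TotalSpace F A,
          infinitesimalGenerator (IG.prod 𝓘(ℝ, EG)) (IM.prod 𝓘(ℝ, F)) (inducedAction Φ ψ)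
            (TangentGroup.lieMk ξ η) a = V a + verticalLift (ψ η) a := by
  -- The complete lift of ψ(ξ) is supplied by the hypothesis: it is the generator of Φ itself.
  exact ⟨hΦ.isAffineAction_inducedAction, fun ξ η => ⟨infinitesimalGenerator IG (IM.prod 𝓘(ℝ, F)) Φ ξ,
    hΦ.generator ξ, hΦ.infinitesimalGenerator_inducedAction ξ η⟩⟩
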